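/- Let $\Lambda=\mathbb Z[t^{\pm1}]$. Let $L$ be a classical oriented link with two components, presented by a link diagram $D$ without virtual crossings, with set of arcs $A(D)$ and set of crossings $C(D)$. At a crossing $c$ let $a(c)$ be the overpassing arc, and let $b_1(c)$ and $b_2(c)$ be the underpassing arcs on the right and on the left of $a(c)$, respectively. The medial quandle $\mathrm{MQ}(L)$ is the medial quandle with a generator $q_a$ for each $a\in A(D)$ and a relation $q_{b_1(c)}\triangleright q_{a(c)}=q_{b_2(c)}$ for each $c\in C(D)$; medial means that $(w\triangleright x)\triangleright(y\triangleright z)=(w\triangleright y)\triangleright(x\triangleright z)$ for all $w,x,y,z$. The reduced Alexander module $M=M_A^{\mathrm{red}}(L)$ is the quotient of the free $\Lambda$-module on $A(D)$ by the submodule generated by the elements $(1-t)a(c)+t\,b_1(c)-b_2(c)$, $c\in C(D)$. The reduced Crowell map $\phi_L^{\mathrm{red}}:M\to\Lambda$ is the $\Lambda$-linear map that sends the generator of $M$ given by any arc to $1$. Let $N=\ker\phi_L^{\mathrm{red}}$ and $X=\{x\in N\mid (1-t)x=0\}$. If $I$ is a nonempty set, $m_i\in M$ for $i\in I$ with $m_i-m_j\in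 N$ for all $i,j\in I$, and $X_i$ is a submodule of $N$ with $(1-t)X_i=0$ for each $i\in I$, then $Q(N,(m_i),(X_i))$ denotes the medial quandle whose underlying set is the disjoint union of the quotients $N/X_i$, $i\in I$, with $$(x+X_i)\triangleright(y+X_j)=m_j-m_i+tx+(1-t)y+X_i\qquad(x,y\in N).$$ Theorem. The group $N/(1-t)N$ is isomorphic to $\mathbb Z$. If $d$ is any element of $N$ whose coset $d+(1-t)N$ generates $N/(1-t)N$, then the medial quandles $\mathrm{MQ}(L)$ and $Q(N,(d,0),(X,X))$ are isomorphic. -/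

import Mathlib

open LaurentPolynomial
open scoped Quandles

/-- The ring `Λ = ℤ[t, t⁻¹]`; the indeterminate is `t = T 1`. -/
abbrev Lam : Type := LaurentPolynomial ℤ

/-- The indeterminate `t` of `Λ`. -/
noncomputable abbrev tt : Lam := T 1

/-! ### Link diagrams

The underlying 4-valent graph of an oriented diagram is recorded by its half-edges.  At each crossing
the four half-edges are listed counterclockwise, beginning with the outgoing end of the overpassing
strand:
`0` is the outgoing end of the overpassing strand,
`1` is the end of the underpassing strand on the left of the overpassing strand,
`2` is the incoming end of the overpassing strand,
`3` is the end of the underpassing strand on the right of the overpassing strand.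
The underpassing strand runs from right to left at a positive crossing, from left to right at a
negative one. -/

/-- The half-edge `(c, k)`, with `k` a position at the crossing `c` as above, points away from the
crossing (`true`) or into it (`false`). -/
def halfEdgeOut {n : ℕ} (positive : Fin n → Bool) : Fin n × Fin 4 → Bool
  | (_, 0) => true
  | (c, 1) => positive c
  | (_, 2) => false
  | (c, 3) => !(positive c)

/-- An oriented (virtual) link diagram, as a signed Gauss code: `n` classical crossings with their
signs, the way in which the half-edges at the crossings are joined in pairs to form the edges of the
diagram (outgoing ends to incoming ends), and the number of components without classical crossings.
Virtual crossings are not recorded: the diagram is considered up to detour moves. -/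
structure LinkDiagram where
  /-- The number of classical crossings. -/
  n : ℕ
  /-- The signs of the crossings. -/
  positive : Fin n → Bool
  /-- The other end of the edge that begins with a given half-edge. -/
  opp : Fin n × Fin 4 → Fin n × Fin 4
  opp_opp : ∀ h, opp (opp h) = h
  out_opp : ∀ h, halfEdgeOut positive (opp h) = !(halfEdgeOut positive h)
  /-- The number of components on which there are no classical crossings. -/
  circles : ℕ

namespace LinkDiagram

variable (D : LinkDiagram)

/-- The set `C(D)` of crossings. -/
abbrev Crossing : Type := Fin D.n

/-- The half-edges. -/
abbrev HalfEdge : Type := Fin D.n × Fin 4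

/-- Rotation by a quarter turn, counterclockwise, about a crossing. -/
def rot (h : D.HalfEdge) : D.HalfEdge := (h.1, h.2 + 1)

/-- The arcs on the components that have crossings: half-edges are identified if they are the two
ends of an edge, or the two ends of the overpassing strand at a crossing. -/
inductive ArcStep : D.HalfEdge → D.HalfEdge → Prop
  | edge (h : D.HalfEdge) : ArcStep h (D.opp h)
  | overpass (c : D.Crossing) : ArcStep (c, 0) (c, 2)

/-- The set `A(D)` of arcs. A component without crossings is a single arc. -/
def Arc : Type := Quot D.ArcStep ⊕ Fin D.circles

/-- The arc that contains a given half-edge. -/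
def arcOf (h : D.HalfEdge) : D.Arc := Sum.inl (Quot.mk _ h)

/-- The overpassing arc at a crossing. -/
def a (c : D.Crossing) : D.Arc := D.arcOf (c, 0)

/-- The underpassing arc on the right of the overpassing arc. -/
def b₁ (c : D.Crossing) : D.Arc := D.arcOf (c, 3)

/-- The underpassing arc on the left of the overpassing arc. -/
def b₂ (c : D.Crossing) : D.Arc := D.arcOf (c, 1)

/-- Following a component: along an edge, or straight through a crossing. -/
inductive ComponentStep : D.HalfEdge → D.HalfEdge → Prop
  | edge (h : D.HalfEdge) : ComponentStep h (D.opp h)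
  | through (h : D.HalfEdge) : ComponentStep h (D.rot (D.rot h))

/-- The components `K₁, …, K_μ` of the link. -/
def Component : Type := Quot D.ComponentStep ⊕ Fin D.circles

/-- The number `μ` of components of the link. -/
noncomputable def numComponents : ℕ := Nat.card D.Component

/-- Moving within a connected piece of the 4-valent graph. -/
inductive PieceStep : D.HalfEdge → D.HalfEdge → Prop
  | edge (h : D.HalfEdge) : PieceStep h (D.opp h)
  | turn (h : D.HalfEdge) : PieceStep h (D.rot h)

/-- The connected components of the 4-valent graph. -/
def Piece : Type := Quot D.PieceStep

/-- The faces of the 4-valent graph, i.e. the cycles of the permutation `rot ∘ opp` of the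
half-edges: the boundary circuits of the surface obtained by thickening the graph. -/
def Face : Type := Quot (fun h h' : D.HalfEdge => h' = D.rot (D.opp h))

/-- The diagram is classical, i.e. it can be drawn in the plane without virtual crossings: capping
off the faces gives a surface all of whose pieces are spheres. As no piece can have an Euler
characteristic greater than 2, this is Euler's formula `V - E + F = 2 * #pieces`, where `V` is the
number of crossings, and `E = 2 * V`. -/
def IsClassical : Prop :=
  (D.n : ℤ) - 2 * D.n + Nat.card D.Face = 2 * Nat.card D.Piece

end LinkDiagram

/-! ### Medial quandles presented by generators and relations

Mathlib writes quandle operations with the acting element on the left: the element written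
`x ▷ y` by authors who let quandles act on the right is `y ◃ x`. A quandle is medial if
`(w ▷ x) ▷ (y ▷ z) = (w ▷ y) ▷ (x ▷ z)`, which is Mathlib's `Rack.IsAbelian`. -/

/-- Formal quandle expressions in generators from `A`; `act y x` stands for `x ▷ y`, and
`invAct y x` for the element `z` with `z ▷ y = x`. -/
inductive QuandleExpr (A : Type) : Type
  | gen (i : A) : QuandleExpr A
  | act (y x : QuandleExpr A) : QuandleExpr A
  | invAct (y x : QuandleExpr A) : QuandleExpr A

/-- The smallest congruence that imposes the laws of medial quandles and the relations
`b₁ c ▷ a c = b₂ c`. -/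
inductive MedialRel {A C : Type} (b₁ a b₂ : C → A) : QuandleExpr A → QuandleExpr A → Prop
  | refl (x) : MedialRel b₁ a b₂ x x
  | symm {x y} : MedialRel b₁ a b₂ x y → MedialRel b₁ a b₂ y x
  | trans {x y z} : MedialRel b₁ a b₂ x y → MedialRel b₁ a b₂ y z → MedialRel b₁ a b₂ x z
  | congr_act {y y' x x'} : MedialRel b₁ a b₂ y y' → MedialRel b₁ a b₂ x x' →
      MedialRel b₁ a b₂ (.act y x) (.act y' x')
  | congr_invAct {y y' x x'} : MedialRel b₁ a b₂ y y' → MedialRel b₁ a b₂ x x' →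
      MedialRel b₁ a b₂ (.invAct y x) (.invAct y' x')
  | self_distrib (x y z) :
      MedialRel b₁ a b₂ (.act x (.act y z)) (.act (.act x y) (.act x z))
  | left_inv (x y) : MedialRel b₁ a b₂ (.invAct x (.act x y)) y
  | right_inv (x y) : MedialRel b₁ a b₂ (.act x (.invAct x y)) y
  | fix (x) : MedialRel b₁ a b₂ (.act x x) x
  | medial (x y z w) :
      MedialRel b₁ a b₂ (.act (.act x y) (.act z w)) (.act (.act x z) (.act y w))
  | rel (c : C) : MedialRel b₁ a b₂ (.act (.gen (a c)) (.gen (b₁ c))) (.gen (b₂ c))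

/-- The setoid of `MedialRel`. -/
def MedialRel.setoid {A C : Type} (b₁ a b₂ : C → A) : Setoid (QuandleExpr A) where
  r := MedialRel b₁ a b₂
  iseqv := ⟨.refl, .symm, .trans⟩

/-- The medial quandle with generators `A` and relations `b₁ c ▷ a c = b₂ c` for `c` in `C`. -/
def PresentedMedialQuandle {A C : Type} (b₁ a b₂ : C → A) : Type :=
  Quotient (MedialRel.setoid b₁ a b₂)

instance {A C : Type} (b₁ a b₂ : C → A) : Quandle (PresentedMedialQuandle b₁ a b₂) where
  act := Quotient.map₂ .act fun _ _ h _ _ h' => .congr_act h h'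
  self_distrib := by
    rintro ⟨x⟩ ⟨y⟩ ⟨z⟩
    exact Quotient.sound (.self_distrib x y z)
  invAct := Quotient.map₂ .invAct fun _ _ h _ _ h' => .congr_invAct h h'
  left_inv := by
    rintro ⟨x⟩ ⟨y⟩
    exact Quotient.sound (.left_inv x y)
  right_inv := by
    rintro ⟨x⟩ ⟨y⟩
    exact Quotient.sound (.right_inv x y)
  fix := by
    rintro ⟨x⟩
    exact Quotient.sound (.fix x)

/-- The medial quandle `MQ(L)`, computed from a diagram `D` of `L`. -/
abbrev LinkDiagram.MQ (D : LinkDiagram) : Type := PresentedMedialQuandle D.b₁ D.a D.b₂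

/-! ### The reduced Alexander module and the reduced Crowell map -/

namespace LinkDiagram

variable (D : LinkDiagram)

/-- The map `Λ^C(D) → Λ^A(D)`, `c ↦ (1 - t) a(c) + t b₁(c) - b₂(c)`. -/
noncomputable def rhoRed : (D.Crossing →₀ Lam) →ₗ[Lam] (D.Arc →₀ Lam) :=
  Finsupp.linearCombination Lam fun c =>
    (1 - tt) • Finsupp.single (D.a c) 1 + tt • Finsupp.single (D.b₁ c) 1
      - Finsupp.single (D.b₂ c) 1

/-- The reduced Alexander module of the link: the cokernel of `rhoRed`. -/
abbrev AlexanderModuleRed : Type := (D.Arc →₀ Lam) ⧸ LinearMap.range D.rhoRed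

/-- The reduced Crowell map, under which the generator of each arc is mapped to `1`. -/
noncomputable def crowellRed : D.AlexanderModuleRed →ₗ[Lam] Lam :=
  (LinearMap.range D.rhoRed).liftQ (Finsupp.linearCombination Lam fun _ => 1) (by
    rw [LinearMap.range_le_ker_iff]
    ext c
    simp [rhoRed])

/-- The reduced Alexander invariant of the link. -/
noncomputable abbrev alexanderInvariantRed : Submodule Lam D.AlexanderModuleRed :=
  LinearMap.ker D.crowellRed

end LinkDiagram

/-! ### The medial quandles `Q(N, (mᵢ), (Xᵢ))` -/

/-- The data that define a quandle `Q(N, (mᵢ), (Xᵢ))`, where `N` is a submodule of a `Λ`-module `M`: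
elements `mᵢ` of `M` that are congruent to each other modulo `N`, and submodules `Xᵢ` of `N` that are
annihilated by `1 - t`. -/
structure MedialData {M : Type*} [AddCommGroup M] [Module Lam M] (N : Submodule Lam M)
    (I : Type*) where
  m : I → M
  X : I → Submodule Lam N
  sub_mem : ∀ i j, m i - m j ∈ N
  ann : ∀ i, ∀ x ∈ X i, (1 - tt) • x = 0

namespace MedialData

variable {M : Type*} [AddCommGroup M] [Module Lam M] {N : Submodule Lam M} {I : Type*}

/-- The underlying set of `Q(N, (mᵢ), (Xᵢ))`: the disjoint union of the quotients `N / Xᵢ`. -/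
def Q (S : MedialData N I) : Type _ := Σ i, N ⧸ S.X i

variable (S : MedialData N I)

/-- The difference `mᵢ - mⱼ`, as an element of `N`. -/
def diff (i j : I) : N := ⟨S.m i - S.m j, S.sub_mem i j⟩

/-- The map `N / Xⱼ → N / Xᵢ`, `y + Xⱼ ↦ (1 - t) y + Xᵢ`. -/
noncomputable def mulOneSub (j i : I) : (N ⧸ S.X j) →ₗ[Lam] (N ⧸ S.X i) :=
  (S.X j).mapQ (S.X i) ((1 - tt) • LinearMap.id) (fun x hx => by
    simp [S.ann j x hx])

/-- The operation `x ▷ y = mⱼ - mᵢ + t x + (1 - t) y + Xᵢ`, for `x` in `N / Xᵢ`, `y` in `N / Xⱼ`. -/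
noncomputable def op (x y : S.Q) : S.Q :=
  ⟨x.1, (S.X x.1).mkQ (S.diff y.1 x.1) + tt • x.2 + S.mulOneSub y.1 x.1 y.2⟩

/-- The inverse operation of `op`. -/
noncomputable def invOp (x y : S.Q) : S.Q :=
  ⟨x.1, (T (-1) : Lam) • (x.2 - (S.X x.1).mkQ (S.diff y.1 x.1) - S.mulOneSub y.1 x.1 y.2)⟩

/-- The element `x + Xᵢ` of `N / Xᵢ`. -/
noncomputable def coset (i : I) (x : N) : S.Q := ⟨i, (S.X i).mkQ x⟩

theorem exists_coset (q : S.Q) : ∃ i x, q = S.coset i x := by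
  obtain ⟨i, x⟩ := q
  obtain ⟨x, rfl⟩ := Submodule.mkQ_surjective _ x
  exact ⟨i, x, rfl⟩

theorem op_coset (i j : I) (x y : N) :
    S.op (S.coset i x) (S.coset j y) = S.coset i (S.diff j i + tt • x + (1 - tt) • y) := rfl

theorem invOp_coset (i j : I) (x y : N) :
    S.invOp (S.coset i x) (S.coset j y) =
      S.coset i ((T (-1) : Lam) • (x - S.diff j i - (1 - tt) • y)) := rfl

noncomputable instance : Quandle S.Q where
  act y x := S.op x y
  invAct y x := S.invOp x y
  self_distrib := by
    intro x y z
    obtain ⟨k, z, rfl⟩ := S.exists_coset z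
    obtain ⟨j, y, rfl⟩ := S.exists_coset y
    obtain ⟨i, x, rfl⟩ := S.exists_coset x
    simp only [op_coset]
    refine congrArg (S.coset k) (Subtype.ext ?_)
    simp only [diff, Submodule.coe_add, Submodule.coe_smul]
    module
  left_inv := by
    intro y x
    obtain ⟨j, y, rfl⟩ := S.exists_coset y
    obtain ⟨i, x, rfl⟩ := S.exists_coset x
    simp only [op_coset, invOp_coset]
    rw [show ∀ p q r : N, p + q + r - p - r = q by intros; abel, smul_smul, ← T_add]
    simp
  right_inv := by
    intro y x
    obtain ⟨j, y, rfl⟩ := S.exists_coset y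
    obtain ⟨i, x, rfl⟩ := S.exists_coset x
    simp only [op_coset, invOp_coset]
    rw [smul_smul, ← T_add]
    rw [add_neg_cancel, T_zero, one_smul]
    exact congrArg _ (by abel)
  fix := by
    intro x
    obtain ⟨i, x, rfl⟩ := S.exists_coset x
    simp only [op_coset]
    refine congrArg (S.coset i) (Subtype.ext ?_)
    simp only [diff, Submodule.coe_add, Submodule.coe_smul]
    module

/-- The quandle `Q(N, (mᵢ), (Xᵢ))` is medial. -/
theorem isAbelian : Rack.IsAbelian S.Q := by
  intro x y z w
  obtain ⟨i, x, rfl⟩ := S.exists_coset x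
  obtain ⟨j, y, rfl⟩ := S.exists_coset y
  obtain ⟨k, z, rfl⟩ := S.exists_coset z
  obtain ⟨l, w, rfl⟩ := S.exists_coset w
  change S.op (S.op _ _) (S.op _ _) = S.op (S.op _ _) (S.op _ _)
  simp only [op_coset]
  refine congrArg (S.coset l) (Subtype.ext ?_)
  simp only [diff, Submodule.coe_add, Submodule.coe_smul]
  module

/-- The data for `Q(N, (d, 0), (X, X))`, where `d` is in `N` and `X` is the submodule of all elements
of `N` annihilated by `1 - t`. -/
noncomputable def pair (N : Submodule Lam M) (d : N) : MedialData N (Fin 2) where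
  m := ![(d : M), 0]
  X := fun _ => Submodule.torsionBy Lam N (1 - tt)
  sub_mem := by
    have h : ∀ i, ![(d : M), 0] i ∈ N := by
      intro i
      fin_cases i <;> simp
    exact fun i j => N.sub_mem (h i) (h j)
  ann := fun _ _ hx => hx

end MedialData

/-- The submodule `(1 - t) N` of a `Λ`-module `N`. -/
noncomputable def oneSubTMul (N : Type*) [AddCommGroup N] [Module Lam N] : Submodule Lam N :=
  LinearMap.range (LinearMap.lsmul Lam N (1 - tt))

/-!
Every `Λ`-module is a quandle under `x ▷ y = t x + (1 - t) y`. Both `MQ(L)` and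
`Q(N, (d, 0), (X, X))` map to this Alexander quandle of the reduced Alexander module `M`. Both maps
have the same image, the union of the cosets of `(1 - t) N` in `M` that contain the class of an arc,
and two arcs determine the same coset if and only if they are on the same component. What remains is
that both maps are injective.

For the second map this is clear, as `X` is the kernel of the multiplication by `1 - t` on `N`. For
the first one, `N` acts on `MQ(L)` by displacements, in such a way that the map to `M` turns the
action of `x` into the translation by `(1 - t) x`. The orbits are the components, so injectivity
means that every `x` with `(1 - t) x = 0` acts trivially. Such elements are combinations of the
longitudes of the components, and the longitude of a component fixes the generators given by its
own arcs. For a classical diagram, Euler's formula gives an Alexander numbering of the faces, and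
the numbering yields a relation between the relators of `M` that makes the sum of the longitudes
vanish. If there are two components, it follows that each of the two longitudes is the negative of
the other one, so that both act trivially.
-/

/-! ### Laurent polynomials -/

section LaurentPolynomial

/-- The augmentation `Λ → ℤ`, `t ↦ 1`. -/
noncomputable def aug : Lam →+* ℤ := LaurentPolynomial.eval₂ (RingHom.id ℤ) 1

@[simp] theorem aug_T (n : ℤ) : aug (T n) = 1 := by simp [aug]

@[simp] theorem aug_C (a : ℤ) : aug (C a) = a := by simp [aug]

theorem one_sub_tt_dvd_T_sub_one (n : ℤ) : (1 - tt) ∣ (T n - 1 : Lam) := by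
  have dvd_natCast (m : ℕ) : (1 - tt) ∣ (T m - 1 : Lam) := by
    have h := sub_dvd_pow_sub_pow tt (1 : Lam) m
    rwa [one_pow, tt, T_pow, mul_one, ← neg_dvd, neg_sub] at h
  obtain ⟨m, rfl | rfl⟩ := n.eq_nat_or_neg
  · exact dvd_natCast m
  · have : (T (-m) - 1 : Lam) = -T (-m) * (T m - 1) := by
      rw [mul_sub, neg_mul, ← T_add]
      simp [neg_add_eq_sub]
    rw [this]
    exact (dvd_natCast m).mul_left _

theorem one_sub_tt_dvd_sub_C_aug (p : Lam) : (1 - tt) ∣ p - C (aug p) := by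
  induction p using LaurentPolynomial.induction_on' with
  | add p q hp hq =>
    rw [map_add, map_add, add_sub_add_comm]
    exact dvd_add hp hq
  | C_mul_T n a =>
    rw [map_mul, aug_T, aug_C, mul_one, ← mul_sub_one]
    exact (one_sub_tt_dvd_T_sub_one n).mul_left _

theorem aug_eq_zero_iff {p : Lam} : aug p = 0 ↔ (1 - tt) ∣ p := by
  refine ⟨fun h => by simpa [h] using one_sub_tt_dvd_sub_C_aug p, ?_⟩
  rintro ⟨q, rfl⟩
  simp

theorem one_sub_tt_ne_zero : (1 - tt : Lam) ≠ 0 := by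
  rw [sub_ne_zero, ← T_zero]
  exact fun h => absurd (AddMonoidAlgebra.single_left_injective one_ne_zero h) zero_ne_one

variable {M : Type*} [AddCommGroup M] [Module Lam M]

theorem tt_smul_eq_iff {x y : M} : tt • x = y ↔ x = (T (-1) : Lam) • y := by
  constructor <;> rintro rfl <;> rw [smul_smul, ← T_add] <;> simp

theorem span_toAddSubgroup_eq_closure {s : Set M} (hs : ∀ (n : ℤ), ∀ x ∈ s, (T n : Lam) • x ∈ s) :
    (Submodule.span Lam s).toAddSubgroup = AddSubgroup.closure s := by
  refine le_antisymm (fun x hx => ?_) ((AddSubgroup.closure_le _).2 Submodule.subset_span)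
  have smul_mem (p : Lam) (y : M) (hy : y ∈ s) : p • y ∈ AddSubgroup.closure s := by
    induction p using LaurentPolynomial.induction_on' with
    | add p q hp hq =>
      rw [add_smul]
      exact add_mem hp hq
    | C_mul_T n a =>
      rw [← smul_eq_C_mul, smul_assoc]
      exact zsmul_mem (AddSubgroup.subset_closure (hs n y hy)) a
  refine Submodule.closure_induction (zero_mem _) (fun _ _ _ _ => add_mem) smul_mem hx

theorem oneSubTMul_le_ker (f : M →ₛₗ[aug] ℤ) : oneSubTMul M ≤ LinearMap.ker f := by
  rintro _ ⟨x, rfl⟩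
  simp

theorem one_sub_tt_smul_eq_zero (x : M ⧸ oneSubTMul M) : (1 - tt) • x = 0 := by
  obtain ⟨x, rfl⟩ := Submodule.mkQ_surjective _ x
  rw [← map_smul, Submodule.mkQ_apply, Submodule.Quotient.mk_eq_zero]
  exact ⟨x, rfl⟩

theorem bijective_of_span_singleton_eq_top {e : M} (he : Submodule.span Lam {e} = ⊤)
    (hM : ∀ x : M, (1 - tt) • x = 0) {f : M →ₛₗ[aug] ℤ} (hf : f e = 1) :
    Function.Bijective f := by
  refine ⟨(injective_iff_map_eq_zero f).2 fun x hx => ?_, fun n => ⟨C n • e, by simp [hf]⟩⟩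
  obtain ⟨p, rfl⟩ := Submodule.mem_span_singleton.1 (he.ge (Submodule.mem_top (x := x)))
  rw [map_smulₛₗ, hf, smul_eq_mul, mul_one, aug_eq_zero_iff] at hx
  obtain ⟨q, rfl⟩ := hx
  rw [mul_smul, hM]

theorem eq_or_eq_neg_of_span_singleton_eq_top {e d : M} (hd : Submodule.span Lam {d} = ⊤)
    {f : M →ₛₗ[aug] ℤ} (hinj : Function.Injective f) (hf : f e = 1) : d = e ∨ d = -e := by
  obtain ⟨p, hp⟩ := Submodule.mem_span_singleton.1 (hd.ge (Submodule.mem_top (x := e)))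
  have h : aug p * f d = 1 := by rw [← hf, ← hp, map_smulₛₗ, smul_eq_mul]
  refine (Int.eq_one_or_neg_one_of_mul_eq_one' h).imp (fun h => hinj ?_) fun h => hinj ?_
  · rw [h.2, hf]
  · rw [h.2, map_neg, hf]

end LaurentPolynomial

/-! ### Alexander quandles -/

/-- The Alexander quandle of a `Λ`-module: the operation is `x ▷ y = t x + (1 - t) y`. -/
@[reducible] noncomputable def alexanderQuandle (M : Type*) [AddCommGroup M] [Module Lam M] :
    Quandle M where
  act y x := tt • x + (1 - tt) • y
  invAct y x := (T (-1) : Lam) • (x - (1 - tt) • y)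
  self_distrib {_ _ _} := by module
  left_inv _ _ := by
    dsimp only
    rw [add_sub_cancel_right, ← tt_smul_eq_iff.1 rfl]
  right_inv _ _ := by
    dsimp only
    rw [tt_smul_eq_iff.2 rfl, sub_add_cancel]
  fix {_} := by module

attribute [local instance] alexanderQuandle

section AlexanderQuandle

variable {M M' : Type*} [AddCommGroup M] [Module Lam M] [AddCommGroup M'] [Module Lam M']

theorem alexanderQuandle_act (y x : M) : y ◃ x = tt • x + (1 - tt) • y := rfl

theorem alexanderQuandle_isAbelian : Rack.IsAbelian M := by
  intro x y z w
  simp only [alexanderQuandle_act]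
  module

/-- A linear map, as a homomorphism of Alexander quandles. -/
noncomputable def alexanderQuandleMap (f : M →ₗ[Lam] M') : M →◃ M' where
  toFun := f
  map_act' := by simp [alexanderQuandle_act]

theorem alexanderHom_act {Q : Type*} [Shelf Q] (F : Q →◃ M) (y x : Q) :
    F (y ◃ x) = tt • F x + (1 - tt) • F y := F.map_act

theorem alexanderHom_act'_zpow {Q : Type*} [Rack Q] (F : Q →◃ M) (y : Q) (n : ℤ) (x : Q) :
    F ((Rack.act' y ^ n) x) = (T n : Lam) • F x + (1 - T n : Lam) • F y := by
  have succ (n : ℤ) : F ((Rack.act' y ^ (1 + n)) x) =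
      tt • F ((Rack.act' y ^ n) x) + (1 - tt) • F y := by
    rw [zpow_one_add, Equiv.Perm.mul_apply, Rack.act'_apply, alexanderHom_act]
  induction n using Int.induction_on with
  | zero => simp
  | succ n ih =>
    rw [add_comm (n : ℤ), succ, ih, T_add]
    module
  | pred n ih =>
    rw [show -(n : ℤ) = 1 + (-n - 1) by ring, succ, T_add, ← eq_sub_iff_add_eq,
      tt_smul_eq_iff] at ih
    rw [ih, eq_comm, ← tt_smul_eq_iff]
    module

theorem exists_bijective_shelfHom {Q Q' S : Type*} [Shelf Q] [Shelf Q'] [Shelf S] {F : Q →◃ S}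
    {G : Q' →◃ S} (hF : Function.Injective F) (hG : Function.Injective G)
    (h : Set.range F = Set.range G) : ∃ f : Q →◃ Q', Function.Bijective f := by
  let e : Q ≃ Q' := (Equiv.ofInjective F hF).trans
    ((Equiv.setCongr h).trans (Equiv.ofInjective G hG).symm)
  have map_e (x : Q) : G (e x) = F x := Equiv.apply_ofInjective_symm hG _
  exact ⟨⟨e, hG (by simp only [map_e, ShelfHom.map_act])⟩, e.bijective⟩

end AlexanderQuandle

/-! ### Presented medial quandles -/

/-- The value of a quandle expression under an assignment of elements of a quandle to the
generators. -/
def QuandleExpr.eval {A : Type} {Q : Type*} [Quandle Q] (f : A → Q) : QuandleExpr A → Q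
  | .gen i => f i
  | .act y x => y.eval f ◃ x.eval f
  | .invAct y x => y.eval f ◃⁻¹ x.eval f

theorem MedialRel.eval_eq {A C : Type} {Q : Type*} [Quandle Q] (hQ : Rack.IsAbelian Q)
    {b₁ a b₂ : C → A} {f : A → Q} (hf : ∀ c, f (a c) ◃ f (b₁ c) = f (b₂ c)) {x y : QuandleExpr A}
    (h : MedialRel b₁ a b₂ x y) : x.eval f = y.eval f := by
  induction h with
  | refl => rfl
  | symm _ h => exact h.symm
  | trans _ _ h h' => exact h.trans h'
  | congr_act _ _ h h' => simp only [QuandleExpr.eval, h, h']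
  | congr_invAct _ _ h h' => simp only [QuandleExpr.eval, h, h']
  | self_distrib => exact Shelf.self_distrib
  | left_inv x y => exact Rack.left_inv _ _
  | right_inv x y => exact Rack.right_inv _ _
  | fix => exact Quandle.fix
  | medial => exact hQ _ _ _ _
  | rel c => exact hf c

namespace PresentedMedialQuandle

variable {A C : Type} {b₁ a b₂ : C → A}

variable (b₁ a b₂) in
/-- The generators of a presented medial quandle. -/
def of (i : A) : PresentedMedialQuandle b₁ a b₂ := Quotient.mk _ (.gen i)

@[elab_as_elim]
theorem induction {P : PresentedMedialQuandle b₁ a b₂ → Prop} (hof : ∀ i, P (of b₁ a b₂ i))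
    (hact : ∀ y x, P y → P x → P (y ◃ x)) (hinv : ∀ y x, P y → P x → P (y ◃⁻¹ x)) (x) : P x := by
  obtain ⟨x⟩ := x
  induction x with
  | gen i => exact hof i
  | act y x hy hx => exact hact _ _ hy hx
  | invAct y x hy hx => exact hinv _ _ hy hx

theorem isAbelian : Rack.IsAbelian (PresentedMedialQuandle b₁ a b₂) := by
  rintro ⟨x⟩ ⟨y⟩ ⟨z⟩ ⟨w⟩
  exact Quotient.sound (.medial x y z w)

theorem act_of (c : C) : of b₁ a b₂ (a c) ◃ of b₁ a b₂ (b₁ c) = of b₁ a b₂ (b₂ c) :=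
  Quotient.sound (.rel c)

/-- The homomorphism to a medial quandle given by an assignment that respects the relations. -/
def lift {Q : Type*} [Quandle Q] (hQ : Rack.IsAbelian Q) (f : A → Q)
    (hf : ∀ c, f (a c) ◃ f (b₁ c) = f (b₂ c)) : PresentedMedialQuandle b₁ a b₂ →◃ Q where
  toFun := Quotient.lift (QuandleExpr.eval f) fun _ _ => MedialRel.eval_eq hQ hf
  map_act' := by
    rintro ⟨y⟩ ⟨x⟩
    rfl

theorem hom_eqOn {Q : Type*} [Rack Q] {F G : PresentedMedialQuandle b₁ a b₂ →◃ Q}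
    (h : ∀ i, F (of b₁ a b₂ i) = G (of b₁ a b₂ i)) (x) : F x = G x := by
  induction x using PresentedMedialQuandle.induction with
  | hof i => exact h i
  | hact y x hy hx => rw [F.map_act, G.map_act, hy, hx]
  | hinv y x hy hx =>
    rw [← Rack.left_cancel (F y), ← F.map_act, hy, ← G.map_act, Rack.act_invAct_eq, hx]

end PresentedMedialQuandle

/-! ### Displacements of a medial rack -/

section Displacement

open Rack (act')

variable {Q : Type*} [Rack Q]

variable (Q) in
/-- The displacement group of a rack. -/
def displacementGroup : Subgroup (Equiv.Perm Q) :=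
  Subgroup.closure {g | ∃ y z : Q, g = act' y * (act' z)⁻¹}

theorem act'_mul_inv_act'_mem_displacementGroup (y z : Q) :
    act' y * (act' z)⁻¹ ∈ displacementGroup Q :=
  Subgroup.subset_closure ⟨y, z, rfl⟩

theorem act'_mem_normalizer_displacementGroup (x : Q) :
    act' x ∈ Subgroup.normalizer (displacementGroup Q : Set (Equiv.Perm Q)) := by
  have conj_act' (y z : Q) : act' x * (act' y * (act' z)⁻¹) * (act' x)⁻¹ =
      act' (x ◃ y) * (act' (x ◃ z))⁻¹ := by
    rw [Rack.ad_conj, Rack.ad_conj]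
    group
  refine Subgroup.normalizer_le_normalizer_closure _ (Subgroup.mem_set_normalizer_iff.2 fun g => ?_)
  constructor
  · rintro ⟨y, z, rfl⟩
    exact ⟨_, _, conj_act' y z⟩
  · rintro ⟨y, z, h⟩
    obtain ⟨y, rfl⟩ := (act' x).surjective y
    obtain ⟨z, rfl⟩ := (act' x).surjective z
    rw [Rack.act'_apply, Rack.act'_apply, ← conj_act', mul_left_inj, mul_right_inj] at h
    exact ⟨y, z, h⟩

theorem act'_mul_inv_act'_mul_act'_comm (hQ : Rack.IsAbelian Q) (x y z : Q) :
    act' y * (act' x)⁻¹ * act' z = act' z * (act' x)⁻¹ * act' y := by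
  have h : act' (x ◃ y) * act' z = act' (x ◃ z) * act' y := Equiv.ext fun w => hQ x y z w
  rw [Rack.ad_conj, Rack.ad_conj] at h
  simpa only [mul_assoc, mul_right_inj] using h

theorem isMulCommutative_displacementGroup (hQ : Rack.IsAbelian Q) :
    IsMulCommutative (displacementGroup Q) := by
  refine Subgroup.isMulCommutative_closure ?_
  rintro _ ⟨y, z, rfl⟩ _ ⟨x, w, rfl⟩
  have swap := congrArg (·⁻¹) (act'_mul_inv_act'_mul_act'_comm hQ y z w)
  simp only [mul_inv_rev, inv_inv] at swap
  calc act' y * (act' z)⁻¹ * (act' x * (act' w)⁻¹)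
      = act' y * (act' z)⁻¹ * act' x * (act' w)⁻¹ := by group
    _ = act' x * ((act' z)⁻¹ * (act' y * (act' w)⁻¹)) := by
      rw [act'_mul_inv_act'_mul_act'_comm hQ]
      group
    _ = act' x * (act' w)⁻¹ * (act' y * (act' z)⁻¹) := by
      rw [← swap]
      group

/-- The displacement group of a medial rack, written additively: a `Λ`-module in which `t` acts as
conjugation by the translation of `x₀`. -/
def DisplacementModule (_ : Rack.IsAbelian Q) (_ : Q) : Type _ := Additive (displacementGroup Q)

namespace DisplacementModule

variable (hQ : Rack.IsAbelian Q) (x₀ : Q)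

instance : AddCommGroup (DisplacementModule hQ x₀) :=
  { (inferInstance : AddGroup (Additive (displacementGroup Q))) with
    add_comm := (isMulCommutative_displacementGroup hQ).is_comm.comm }

/-- Conjugation by the powers of the translation of `x₀`. -/
def conjPow : Multiplicative ℤ →* AddMonoid.End (DisplacementModule hQ x₀) where
  toFun n := MonoidHom.toAdditive (MulEquiv.toMonoidHom
    ((displacementGroup Q).normalizerMonoidHom
      (zpowersHom _ ⟨act' x₀, act'_mem_normalizer_displacementGroup x₀⟩ n)))
  map_one' := by
    rw [map_one, map_one]
    rfl
  map_mul' _ _ := by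
    rw [map_mul, map_mul]
    rfl

noncomputable instance : Module Lam (DisplacementModule hQ x₀) :=
  Module.compHom _ (AddMonoidAlgebra.lift ℤ (AddMonoid.End (DisplacementModule hQ x₀)) ℤ
    (conjPow hQ x₀) : Lam →+* AddMonoid.End (DisplacementModule hQ x₀))

/-- The permutation of the rack given by an element of the displacement module. -/
def toPerm : DisplacementModule hQ x₀ →+ Additive (Equiv.Perm Q) :=
  MonoidHom.toAdditive (displacementGroup Q).subtype

theorem toPerm_injective : Function.Injective (toPerm hQ x₀) :=
  (displacementGroup Q).subtype_injective

theorem toPerm_tt_smul (v : DisplacementModule hQ x₀) :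
    (toPerm hQ x₀ (tt • v)).toMul = act' x₀ * (toPerm hQ x₀ v).toMul * (act' x₀)⁻¹ := by
  have : tt • v = conjPow hQ x₀ (.ofAdd 1) v :=
    DFunLike.congr_fun ((AddMonoidAlgebra.lift_single _ _ _).trans (one_smul _ _)) v
  rw [this]
  rfl

/-- The element of the displacement module that takes the translation of `x₀` to that of `y`. -/
def difference (y : Q) : DisplacementModule hQ x₀ :=
  Additive.ofMul (⟨_, act'_mul_inv_act'_mem_displacementGroup y x₀⟩ : displacementGroup Q)

theorem toPerm_difference (y : Q) :
    (toPerm hQ x₀ (difference hQ x₀ y)).toMul = act' y * (act' x₀)⁻¹ := rfl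

/-- `difference`, as a homomorphism to the Alexander quandle of the displacement module. -/
noncomputable def differenceHom : Q →◃ DisplacementModule hQ x₀ where
  toFun := difference hQ x₀
  map_act' {y x} := toPerm_injective hQ x₀ <| Additive.toMul.injective <| by
    have h : difference hQ x₀ y ◃ difference hQ x₀ x = difference hQ x₀ y +
        (tt • difference hQ x₀ x - tt • difference hQ x₀ y) := by
      rw [alexanderQuandle_act]
      module
    rw [h, map_add, map_sub, toMul_add, toMul_sub, toPerm_tt_smul, toPerm_tt_smul]
    simp only [toPerm_difference, Rack.ad_conj, div_eq_mul_inv]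
    group

end DisplacementModule

end Displacement

/-! ### Components -/

namespace LinkDiagram

variable {D : LinkDiagram}

theorem apply_rot_rot {X : Type*} {f : D.HalfEdge → X} (h₀ : ∀ c, f (c, 0) = f (c, 2))
    (h₁ : ∀ c, f (c, 1) = f (c, 3)) (h : D.HalfEdge) : f (D.rot (D.rot h)) = f h := by
  obtain ⟨c, k⟩ := h
  have rot_rot_two : D.rot (D.rot (c, 2)) = (c, 0) :=
    Prod.ext rfl (by decide : (2 : Fin 4) + 1 + 1 = 0)
  fin_cases k
  exacts [(h₀ c).symm, (h₁ c).symm, (congrArg f rot_rot_two).trans (h₀ c), h₁ c]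

/-- The component that contains a given arc. -/
def componentOf : D.Arc → D.Component :=
  Sum.map (Quot.map id (by
    rintro h _ (_ | c)
    exacts [.edge h, .through (c, 0)])) id

theorem componentOf_surjective : Function.Surjective (componentOf (D := D)) :=
  Sum.map_surjective.2 ⟨Quot.ind fun h => ⟨Quot.mk _ h, rfl⟩, Function.surjective_id⟩

theorem componentOf_b₂ (c : D.Crossing) : componentOf (D.b₂ c) = componentOf (D.b₁ c) :=
  congrArg Sum.inl (Quot.sound (.through (c, 1)))

theorem arcOf_two (c : D.Crossing) : D.arcOf (c, 2) = D.a c :=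
  (congrArg Sum.inl (Quot.sound (.overpass c))).symm

theorem arcOf_opp (h : D.HalfEdge) : D.arcOf (D.opp h) = D.arcOf h :=
  (congrArg Sum.inl (Quot.sound (.edge h))).symm

/-- The arcs of a component are joined by underpasses. -/
theorem apply_eq_of_componentOf_eq {X : Type*} {F : D.Arc → X} (hF : ∀ c, F (D.b₁ c) = F (D.b₂ c))
    {α β : D.Arc} (h : componentOf α = componentOf β) : F α = F β := by
  let F' : D.Component → X := Sum.elim (Quot.lift (F ∘ D.arcOf) (by
    rintro h _ (_ | _)
    · exact congrArg F (arcOf_opp h).symm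
    · exact (apply_rot_rot (fun c => congrArg F (arcOf_two c).symm) (fun c => (hF c).symm) h).symm))
    (F ∘ Sum.inr)
  have hF' (α : D.Arc) : F' (componentOf α) = F α := by obtain ⟨⟨h⟩⟩ | k := α <;> rfl
  rw [← hF', h, hF']

theorem eq_or_eq_of_ne (hμ : D.numComponents = 2) {i j : D.Component} (hij : i ≠ j)
    (k : D.Component) : k = i ∨ k = j :=
  or_iff_not_imp_left.2 fun hki =>
    ((Nat.card_eq_two_iff' i).1 hμ).unique hki hij.symm

theorem exists_componentOf_ne (hμ : D.numComponents = 2) :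
    ∃ α₁ α₂ : D.Arc, componentOf α₁ ≠ componentOf α₂ := by
  obtain ⟨i, j, hij, -⟩ := Nat.card_eq_two_iff.1 hμ
  obtain ⟨α₁, rfl⟩ := componentOf_surjective i
  obtain ⟨α₂, rfl⟩ := componentOf_surjective j
  exact ⟨α₁, α₂, hij⟩

end LinkDiagram

/-! ### The reduced Alexander invariant -/

theorem span_range_eq_top_of_sub {R M ι : Type*} [CommRing R] [AddCommGroup M] [Module R M]
    {φ : M →ₗ[R] R} {a : ι → M} (ha : Submodule.span R (Set.range a) = ⊤) (hφ : ∀ i, φ (a i) = 1)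
    (i₀ : ι) {d : ι → LinearMap.ker φ} (hd : ∀ i, (d i : M) = a i - a i₀) :
    Submodule.span R (Set.range d) = ⊤ := by
  let π : M →ₗ[R] LinearMap.ker φ := (LinearMap.id - φ.smulRight (a i₀)).codRestrict _
    fun x => by simp [hφ]
  have coe_π (x : M) : (π x : M) = x - φ x • a i₀ := rfl
  have hπ : Function.Surjective π := fun x => ⟨x, Subtype.ext (by
    rw [coe_π, x.2, zero_smul, sub_zero])⟩
  have π_a : d = π ∘ a := funext fun i => Subtype.ext (by
    rw [Function.comp_apply, coe_π, hφ, hd, one_smul])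
  rw [π_a, Set.range_comp, Submodule.span_image, ha, Submodule.map_top, LinearMap.range_eq_top.2 hπ]

namespace LinkDiagram

variable {D : LinkDiagram}

/-- The generator of the reduced Alexander module given by an arc. -/
noncomputable def arcClass (α : D.Arc) : D.AlexanderModuleRed :=
  (LinearMap.range D.rhoRed).mkQ (Finsupp.single α 1)

@[simp] theorem crowellRed_arcClass (α : D.Arc) : D.crowellRed (arcClass α) = 1 := by
  simp [crowellRed, arcClass]

theorem arcClass_act (c : D.Crossing) :
    arcClass (D.a c) ◃ arcClass (D.b₁ c) = arcClass (D.b₂ c) := by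
  have h : (LinearMap.range D.rhoRed).mkQ (D.rhoRed (Finsupp.single c 1)) = 0 :=
    (Submodule.Quotient.mk_eq_zero _).2 ⟨_, rfl⟩
  rw [rhoRed, Finsupp.linearCombination_single, one_smul, map_sub, map_add, map_smul, map_smul,
    sub_eq_zero, add_comm] at h
  exact h

theorem span_range_arcClass : Submodule.span Lam (Set.range (arcClass (D := D))) = ⊤ := by
  have h : Set.range (arcClass (D := D)) =
      (LinearMap.range D.rhoRed).mkQ '' Set.range fun α => Finsupp.single α (1 : Lam) := by
    rw [← Set.range_comp]
    rfl
  rw [h, Submodule.span_image, ← Finsupp.coe_basisSingleOne, Module.Basis.span_eq,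
    Submodule.map_top, Submodule.range_mkQ]

/-- The difference of the generators given by two arcs, in the reduced Alexander invariant. -/
noncomputable def arcDiff (α β : D.Arc) : D.alexanderInvariantRed :=
  ⟨arcClass α - arcClass β, by simp⟩

theorem coe_arcDiff (α β : D.Arc) :
    (arcDiff α β : D.AlexanderModuleRed) = arcClass α - arcClass β := rfl

theorem arcDiff_self (α : D.Arc) : arcDiff α α = 0 := Subtype.ext (sub_self _)

theorem arcDiff_add_arcDiff (α β γ : D.Arc) : arcDiff α β + arcDiff β γ = arcDiff α γ :=
  Subtype.ext (sub_add_sub_cancel _ _ _)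

theorem neg_arcDiff (α β : D.Arc) : -arcDiff α β = arcDiff β α := Subtype.ext (neg_sub _ _)

theorem arcDiff_b₁_b₂ (c : D.Crossing) :
    arcDiff (D.b₁ c) (D.b₂ c) = (1 - tt) • arcDiff (D.b₁ c) (D.a c) := by
  refine Subtype.ext ?_
  rw [Submodule.coe_smul, coe_arcDiff, coe_arcDiff, ← arcClass_act, alexanderQuandle_act]
  module

theorem span_range_arcDiff (β : D.Arc) :
    Submodule.span Lam (Set.range fun α => arcDiff α β) = ⊤ :=
  span_range_eq_top_of_sub span_range_arcClass crowellRed_arcClass β fun _ => rfl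

open Classical in
/-- The sum of the coefficients at the arcs of a given component, at `t = 1`. -/
noncomputable def componentDegree (i : D.Component) : D.AlexanderModuleRed →ₛₗ[aug] ℤ :=
  (LinearMap.range D.rhoRed).liftQ (aug.toSemilinearMap.comp
    (Finsupp.linearCombination Lam fun α => if componentOf α = i then (1 : Lam) else 0)) (by
      rw [rhoRed, Finsupp.range_linearCombination, Submodule.span_le]
      rintro _ ⟨c, rfl⟩
      simp [componentOf_b₂, apply_ite aug])

open Classical in
theorem componentDegree_arcClass (i : D.Component) (α : D.Arc) :
    componentDegree i (arcClass α) = if componentOf α = i then 1 else 0 := by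
  simp [componentDegree, arcClass, apply_ite aug]

/-- The degree `N / (1 - t) N → ℤ` at a given component. -/
noncomputable def invariantDegree (i : D.Component) :
    (D.alexanderInvariantRed ⧸ oneSubTMul D.alexanderInvariantRed) →ₛₗ[aug] ℤ :=
  (oneSubTMul _).liftQ ((componentDegree i).comp D.alexanderInvariantRed.subtype)
    (oneSubTMul_le_ker _)

theorem invariantDegree_mkQ (i : D.Component) (x : D.alexanderInvariantRed) :
    invariantDegree i ((oneSubTMul _).mkQ x) = componentDegree i x := rfl

theorem invariantDegree_arcDiff {α β : D.Arc} (h : componentOf α ≠ componentOf β) :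
    invariantDegree (componentOf α) ((oneSubTMul _).mkQ (arcDiff α β)) = 1 := by
  rw [invariantDegree_mkQ, coe_arcDiff, map_sub, componentDegree_arcClass,
    componentDegree_arcClass, if_pos rfl, if_neg h.symm, sub_zero]

theorem arcDiff_mem_oneSubTMul_iff {α β : D.Arc} :
    arcDiff α β ∈ oneSubTMul D.alexanderInvariantRed ↔ componentOf α = componentOf β := by
  rw [← Submodule.Quotient.mk_eq_zero, ← Submodule.mkQ_apply]
  constructor
  · intro h
    by_contra hne
    have := invariantDegree_arcDiff hne
    rw [h, map_zero] at this
    exact zero_ne_one this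
  · intro h
    rw [apply_eq_of_componentOf_eq (F := fun α => (oneSubTMul _).mkQ (arcDiff α β)) ?_ h]
    · rw [arcDiff_self, map_zero]
    · intro c
      rw [← sub_eq_zero, ← map_sub, sub_eq_add_neg, neg_arcDiff, arcDiff_add_arcDiff, arcDiff_b₁_b₂]
      exact (Submodule.Quotient.mk_eq_zero _).2 ⟨_, rfl⟩

theorem span_mkQ_arcDiff_eq_top (hμ : D.numComponents = 2) {α₁ α₂ : D.Arc}
    (hne : componentOf α₁ ≠ componentOf α₂) : Submodule.span Lam
      {(oneSubTMul D.alexanderInvariantRed).mkQ (arcDiff α₁ α₂)} = ⊤ := by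
  have mkQ_eq_zero {α β : D.Arc} (h : componentOf α = componentOf β) :
      (oneSubTMul D.alexanderInvariantRed).mkQ (arcDiff α β) = 0 :=
    (Submodule.Quotient.mk_eq_zero _).2 (arcDiff_mem_oneSubTMul_iff.2 h)
  refine top_le_iff.1 ?_
  rw [← (oneSubTMul D.alexanderInvariantRed).range_mkQ,
    LinearMap.range_eq_map (Submodule.mkQ _), ← span_range_arcDiff α₂, Submodule.map_span,
    Submodule.span_le, ← Set.range_comp, Set.range_subset_iff]
  intro α
  rw [SetLike.mem_coe, Function.comp_apply]
  obtain h | h := eq_or_eq_of_ne hμ hne (componentOf α)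
  · rw [← arcDiff_add_arcDiff α α₁ α₂, map_add, mkQ_eq_zero h, zero_add]
    exact Submodule.mem_span_singleton_self _
  · rw [mkQ_eq_zero h]
    exact zero_mem _

theorem invariantDegree_bijective (hμ : D.numComponents = 2) (i : D.Component) :
    Function.Bijective (invariantDegree i) := by
  obtain ⟨j, hij, -⟩ := (Nat.card_eq_two_iff' i).1 hμ
  obtain ⟨α, rfl⟩ := componentOf_surjective i
  obtain ⟨β, rfl⟩ := componentOf_surjective j
  exact bijective_of_span_singleton_eq_top (span_mkQ_arcDiff_eq_top hμ hij.symm)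
    one_sub_tt_smul_eq_zero (invariantDegree_arcDiff hij.symm)

theorem exists_sub_arcDiff_mem (hμ : D.numComponents = 2) {d : D.alexanderInvariantRed}
    (hd : Submodule.span Lam {(oneSubTMul D.alexanderInvariantRed).mkQ d} = ⊤) :
    ∃ α₁ α₂ : D.Arc, componentOf α₁ ≠ componentOf α₂ ∧
      d - arcDiff α₁ α₂ ∈ oneSubTMul D.alexanderInvariantRed := by
  obtain ⟨α₁, α₂, hne⟩ := exists_componentOf_ne hμ
  simp only [← Submodule.Quotient.eq]
  obtain h | h := eq_or_eq_neg_of_span_singleton_eq_top hd (invariantDegree_bijective hμ _).1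
    (invariantDegree_arcDiff hne)
  · exact ⟨α₁, α₂, hne, h⟩
  · rw [← map_neg, neg_arcDiff] at h
    exact ⟨α₂, α₁, hne.symm, h⟩

end LinkDiagram

/-! ### The medial quandle of a link -/

namespace LinkDiagram

open Rack (act')

variable {D : LinkDiagram}

/-- The universal property of the reduced Alexander module. -/
noncomputable def moduleLift {P : Type*} [AddCommGroup P] [Module Lam P] (f : D.Arc → P)
    (hf : ∀ c, f (D.a c) ◃ f (D.b₁ c) = f (D.b₂ c)) : D.AlexanderModuleRed →ₗ[Lam] P :=
  (LinearMap.range D.rhoRed).liftQ (Finsupp.linearCombination Lam f) (by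
    rw [LinearMap.range_le_ker_iff]
    ext c
    simp only [rhoRed, LinearMap.comp_apply, Finsupp.lsingle_apply,
      Finsupp.linearCombination_single, map_sub, map_add, map_smul, one_smul,
      LinearMap.zero_comp, LinearMap.zero_apply, ← hf, alexanderQuandle_act]
    module)

@[simp] theorem moduleLift_arcClass {P : Type*} [AddCommGroup P] [Module Lam P] (f : D.Arc → P)
    (hf : ∀ c, f (D.a c) ◃ f (D.b₁ c) = f (D.b₂ c)) (α : D.Arc) :
    moduleLift f hf (arcClass α) = f α := by
  simp [moduleLift, arcClass]

/-- The generator of the medial quandle given by an arc. -/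
abbrev arcElement (α : D.Arc) : D.MQ := PresentedMedialQuandle.of D.b₁ D.a D.b₂ α

/-- The homomorphism from `MQ(L)` to the Alexander quandle of the reduced Alexander module that
respects the generators given by the arcs. -/
noncomputable def toModule : D.MQ →◃ D.AlexanderModuleRed :=
  PresentedMedialQuandle.lift alexanderQuandle_isAbelian arcClass arcClass_act

@[simp] theorem toModule_arcElement (α : D.Arc) : toModule (arcElement α) = arcClass α := rfl

@[simp] theorem crowellRed_toModule (x : D.MQ) : D.crowellRed (toModule x) = 1 := by
  let one : D.MQ →◃ Lam := ⟨fun _ => 1, by simp⟩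
  exact PresentedMedialQuandle.hom_eqOn (F := (alexanderQuandleMap D.crowellRed).comp toModule)
    (G := one) crowellRed_arcClass x

/-- The difference of the images of two elements of `MQ(L)` in the reduced Alexander module. -/
noncomputable def moduleDiff (y z : D.MQ) : D.alexanderInvariantRed :=
  ⟨toModule y - toModule z, by simp⟩

theorem coe_moduleDiff (y z : D.MQ) :
    (moduleDiff y z : D.AlexanderModuleRed) = toModule y - toModule z := rfl

theorem moduleDiff_arcElement (α β : D.Arc) :
    moduleDiff (arcElement α) (arcElement β) = arcDiff α β := rfl

theorem T_smul_moduleDiff (n : ℤ) (x y z : D.MQ) :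
    (T n : Lam) • moduleDiff y z = moduleDiff ((act' x ^ n) y) ((act' x ^ n) z) := by
  refine Subtype.ext ?_
  rw [Submodule.coe_smul, coe_moduleDiff, coe_moduleDiff, alexanderHom_act'_zpow,
    alexanderHom_act'_zpow]
  module

theorem closure_moduleDiff_eq_top (α : D.Arc) :
    AddSubgroup.closure (Set.range fun p : D.MQ × D.MQ => moduleDiff p.1 p.2) = ⊤ := by
  rw [← span_toAddSubgroup_eq_closure, Submodule.toAddSubgroup_eq_top, ← top_le_iff,
    ← span_range_arcDiff α, Submodule.span_le]
  · rintro _ ⟨β, rfl⟩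
    exact Submodule.subset_span ⟨(arcElement β, arcElement α), rfl⟩
  · rintro n _ ⟨⟨y, z⟩, rfl⟩
    exact ⟨(_, _), (T_smul_moduleDiff n y y z).symm⟩

/-- The linear map that takes the class of an element of `MQ(L)` to its displacement from `x₀`. -/
noncomputable def displacementMap (x₀ : D.MQ) : D.AlexanderModuleRed →ₗ[Lam]
    DisplacementModule PresentedMedialQuandle.isAbelian x₀ :=
  moduleLift (fun α => DisplacementModule.differenceHom _ x₀ (arcElement α)) fun c => by
    rw [← ShelfHom.map_act, arcElement, arcElement, PresentedMedialQuandle.act_of]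

theorem displacementMap_arcClass (x₀ : D.MQ) (α : D.Arc) : displacementMap x₀ (arcClass α) =
    DisplacementModule.difference _ x₀ (arcElement α) :=
  moduleLift_arcClass _ _ α

theorem displacementMap_toModule (x₀ x : D.MQ) :
    displacementMap x₀ (toModule x) = DisplacementModule.difference _ x₀ x :=
  PresentedMedialQuandle.hom_eqOn (F := (alexanderQuandleMap (displacementMap x₀)).comp toModule)
    (G := DisplacementModule.differenceHom _ x₀) (displacementMap_arcClass x₀) x

theorem exists_translation : ∃ θ : D.alexanderInvariantRed →+ Additive (Equiv.Perm D.MQ),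
    ∀ y z : D.MQ, (θ (moduleDiff y z)).toMul = act' y * (act' z)⁻¹ := by
  obtain h | ⟨⟨x₀⟩⟩ := isEmpty_or_nonempty D.MQ
  · exact ⟨0, fun y => isEmptyElim y⟩
  · refine ⟨(DisplacementModule.toPerm _ x₀).comp
      ((displacementMap x₀).comp D.alexanderInvariantRed.subtype).toAddMonoidHom, fun y z => ?_⟩
    change (DisplacementModule.toPerm _ x₀
      (displacementMap x₀ (toModule y - toModule z))).toMul = _
    rw [map_sub, map_sub, displacementMap_toModule, displacementMap_toModule, toMul_sub,
      DisplacementModule.toPerm_difference, DisplacementModule.toPerm_difference, div_eq_mul_inv]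
    group

/-- The reduced Alexander invariant acts on `MQ(L)` by displacements: the difference of the classes
of `y` and `z` acts as the quotient of the translations of `y` and `z`. -/
noncomputable instance : AddAction D.alexanderInvariantRed D.MQ where
  vadd m x := (exists_translation.choose m).toMul x
  zero_vadd x := by
    change (exists_translation.choose 0).toMul x = x
    rw [map_zero]
    rfl
  add_vadd m n x := by
    change (exists_translation.choose (m + n)).toMul x = _
    rw [map_add]
    rfl

theorem moduleDiff_vadd (y z x : D.MQ) : moduleDiff y z +ᵥ x = act' y ((act' z)⁻¹ x) :=
  DFunLike.congr_fun (exists_translation.choose_spec y z) x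

theorem moduleDiff_vadd_self (y x : D.MQ) : moduleDiff y x +ᵥ x = y ◃ x := by
  have h : (act' x)⁻¹ x = x := (Equiv.Perm.inv_eq_iff_eq).2 Quandle.fix.symm
  rw [moduleDiff_vadd, h, Rack.act'_apply]

theorem orbit_act (y x : D.MQ) : AddAction.orbit D.alexanderInvariantRed (y ◃ x) =
    AddAction.orbit D.alexanderInvariantRed x := by
  rw [← moduleDiff_vadd_self, AddAction.orbit_vadd]

theorem orbit_arcElement_eq {α β : D.Arc} (h : componentOf α = componentOf β) :
    AddAction.orbit D.alexanderInvariantRed (arcElement α) =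
      AddAction.orbit D.alexanderInvariantRed (arcElement β) := by
  refine apply_eq_of_componentOf_eq
    (F := fun α => AddAction.orbit D.alexanderInvariantRed (arcElement α)) (fun c => ?_) h
  rw [← orbit_act (arcElement (D.a c)), arcElement, arcElement, PresentedMedialQuandle.act_of]

theorem exists_vadd_arcElement_eq (x : D.MQ) :
    ∃ (α : D.Arc) (m : D.alexanderInvariantRed), m +ᵥ arcElement α = x := by
  suffices ∃ α, AddAction.orbit D.alexanderInvariantRed x =
      AddAction.orbit D.alexanderInvariantRed (arcElement α) from
    this.imp fun _ => AddAction.orbit_eq_iff.1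
  induction x using PresentedMedialQuandle.induction with
  | hof α => exact ⟨α, rfl⟩
  | hact y x _ hx => rwa [orbit_act]
  | hinv y x _ hx => rwa [← orbit_act y, Rack.right_inv]

theorem toModule_vadd (m : D.alexanderInvariantRed) (x : D.MQ) :
    toModule (m +ᵥ x) = toModule x + (1 - tt) • (m : D.AlexanderModuleRed) := by
  obtain ⟨α, -⟩ := exists_vadd_arcElement_eq x
  have hm := (closure_moduleDiff_eq_top α).ge (AddSubgroup.mem_top m)
  induction hm using AddSubgroup.closure_induction generalizing x with
  | mem m hm =>
    obtain ⟨⟨y, z⟩, rfl⟩ := hm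
    have hz := alexanderHom_act'_zpow toModule z (-1) x
    rw [zpow_neg_one] at hz
    rw [moduleDiff_vadd, Rack.act'_apply, alexanderHom_act, hz, coe_moduleDiff, smul_add,
      smul_smul, smul_smul, mul_sub, ← T_add, add_neg_cancel, T_zero]
    module
  | zero => simp
  | add m n _ _ hm hn =>
    rw [add_vadd, hm, hn, Submodule.coe_add]
    module
  | neg m _ hm =>
    have h := hm (-m +ᵥ x)
    rw [vadd_neg_vadd] at h
    rw [h, Submodule.coe_neg]
    module

theorem range_toModule : Set.range (toModule (D := D)) =
    {u | ∃ (α : D.Arc) (m : D.alexanderInvariantRed),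
      u = arcClass α + (1 - tt) • (m : D.AlexanderModuleRed)} := by
  ext u
  constructor
  · rintro ⟨x, rfl⟩
    obtain ⟨α, m, rfl⟩ := exists_vadd_arcElement_eq x
    exact ⟨α, m, toModule_vadd m _⟩
  · rintro ⟨α, m, rfl⟩
    exact ⟨m +ᵥ arcElement α, toModule_vadd m _⟩

theorem toModule_injective_of_vadd_eq
    (h : ∀ (m : D.alexanderInvariantRed) (α : D.Arc), (1 - tt) • m = 0 →
      m +ᵥ arcElement α = arcElement α) : Function.Injective (toModule (D := D)) := by
  intro x y hxy
  obtain ⟨α, m, rfl⟩ := exists_vadd_arcElement_eq x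
  obtain ⟨β, n, rfl⟩ := exists_vadd_arcElement_eq y
  have hcomp : componentOf α = componentOf β := arcDiff_mem_oneSubTMul_iff.1 ⟨n - m, Subtype.ext (by
    rw [toModule_vadd, toModule_vadd, toModule_arcElement, toModule_arcElement] at hxy
    rw [LinearMap.lsmul_apply, Submodule.coe_smul, Submodule.coe_sub, coe_arcDiff, smul_sub,
      sub_eq_sub_iff_add_eq_add, add_comm, ← hxy, add_comm])⟩
  obtain ⟨k, hk⟩ := AddAction.orbit_eq_iff.1 (orbit_arcElement_eq hcomp.symm)
  rw [← hk, vadd_vadd] at hxy ⊢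
  have htorsion : (1 - tt) • (n + k - m) = 0 := Subtype.ext (by
    rw [toModule_vadd, toModule_vadd, add_right_inj, eq_comm, ← sub_eq_zero, ← smul_sub] at hxy
    exact hxy)
  rw [← sub_add_cancel (n + k) m, add_comm, add_vadd, h _ α htorsion]

end LinkDiagram

/-! ### Longitudes -/

namespace LinkDiagram

variable {D : LinkDiagram}

/-- The sign of a half-edge: `1` if it points away from the crossing, `-1` otherwise. -/
def sgn (h : D.HalfEdge) : ℤ := if halfEdgeOut D.positive h then 1 else -1

theorem sgn_opp (h : D.HalfEdge) : sgn (D.opp h) = -sgn h := by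
  unfold sgn
  rw [D.out_opp]
  cases halfEdgeOut D.positive h <;> rfl

@[simp] theorem sgn_zero (c : D.Crossing) : sgn (D := D) (c, 0) = 1 := rfl

@[simp] theorem sgn_two (c : D.Crossing) : sgn (D := D) (c, 2) = -1 := rfl

theorem sgn_one (c : D.Crossing) : sgn (D := D) (c, 1) = if D.positive c then 1 else -1 := rfl

@[simp] theorem sgn_three (c : D.Crossing) : sgn (D := D) (c, 3) = -sgn (D := D) (c, 1) := by
  have h : sgn (D := D) (c, 3) = if !(D.positive c) then 1 else -1 := rfl
  rw [h, sgn_one]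
  cases D.positive c <;> rfl

theorem sgn_mul_self (h : D.HalfEdge) : sgn h * sgn h = 1 := by
  unfold sgn
  split_ifs <;> rfl

theorem sum_eq_zero_of_opp {A : Type*} [AddCommGroup A] {f : D.HalfEdge → A}
    (hf : ∀ h, f (D.opp h) = -f h) : ∑ h, f h = 0 := by
  have opp_ne (h : D.HalfEdge) : D.opp h ≠ h := fun e => by
    have := D.out_opp h
    simp [e] at this
  exact Finset.sum_involution (fun h _ => D.opp h) (fun h _ => by simp [hf])
    (fun h _ _ => opp_ne h) (fun _ _ => Finset.mem_univ _) (fun h _ => D.opp_opp h)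

theorem sum_halfEdge {A : Type*} [AddCommMonoid A] (f : D.HalfEdge → A) :
    ∑ h, f h = ∑ c, (f (c, 0) + f (c, 1) + f (c, 2) + f (c, 3)) := by
  rw [Fintype.sum_prod_type]
  exact Finset.sum_congr rfl fun c _ => Fin.sum_univ_four _

/-- The signed underpasses, weighted by a function on the components. They form a cellular `1`-cycle
of the graph whose vertices are the arcs, and whose edges join `b₁ c` to `b₂ c` for each crossing
`c`. -/
def underCycle (g : D.Component → ℤ) (c : D.Crossing) : ℤ :=
  sgn (D := D) (c, 1) * g (componentOf (D.b₁ c))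

theorem sum_underCycle_smul {A : Type*} [AddCommGroup A] (g : D.Component → ℤ) (p : D.Arc → A) :
    ∑ c, underCycle g c • (p (D.b₂ c) - p (D.b₁ c)) = 0 := by
  let q (h : D.HalfEdge) : A := g (componentOf (D.arcOf h)) • p (D.arcOf h)
  have hq₂ (c : D.Crossing) : q (c, 2) = q (c, 0) := by
    simp only [q]
    rw [arcOf_two]
    rfl
  have hq₁ (c : D.Crossing) : q (c, 1) = g (componentOf (D.b₁ c)) • p (D.b₂ c) :=
    congrArg (g · • p (D.b₂ c)) (componentOf_b₂ c)
  have key : ∑ h, sgn h • q h = 0 := sum_eq_zero_of_opp fun h => by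
    simp only [q, arcOf_opp, sgn_opp, neg_smul]
  rw [← key, sum_halfEdge]
  refine Finset.sum_congr rfl fun c _ => ?_
  change _ = _ + _ + _ + sgn (D := D) (c, 3) • g (componentOf (D.b₁ c)) • p (D.b₁ c)
  rw [hq₁, hq₂, sgn_zero, sgn_two, sgn_three, underCycle]
  module

/-- The functions on the half-edges that take opposite values at the two ends of each edge. -/
def antisymmetricChains (D : LinkDiagram) : AddSubgroup (D.HalfEdge → ℤ) where
  carrier := {f | ∀ h, f (D.opp h) = -f h}
  add_mem' hf hf' h := by
    rw [Pi.add_apply, hf, hf', Pi.add_apply, neg_add]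
  zero_mem' _ := rfl
  neg_mem' hf h := congrArg Neg.neg (hf h)

/-- The functions on the half-edges that take opposite values at the two ends of each overpassing
strand, and vanish at the underpassing strands. -/
def overpassChains (D : LinkDiagram) : AddSubgroup (D.HalfEdge → ℤ) where
  carrier := {f | ∀ c, f (c, 1) = 0 ∧ f (c, 3) = 0 ∧ f (c, 2) = -f (c, 0)}
  add_mem' hf hf' c := by
    obtain ⟨h₁, h₃, h₂⟩ := hf c
    obtain ⟨h₁', h₃', h₂'⟩ := hf' c
    simp only [Pi.add_apply, h₁, h₃, h₂, h₁', h₃', h₂']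
    exact ⟨rfl, rfl, (neg_add _ _).symm⟩
  zero_mem' _ := ⟨rfl, rfl, rfl⟩
  neg_mem' hf c := ⟨by simp [(hf c).1], by simp [(hf c).2.1], by simp [(hf c).2.2]⟩

theorem single_opp_sub_single_mem (h : D.HalfEdge) :
    (Pi.single (D.opp h) 1 - Pi.single h 1 : D.HalfEdge → ℤ) ∈ antisymmetricChains D := by
  intro h'
  have opp_eq_iff : D.opp h' = h ↔ h' = D.opp h :=
    ⟨fun e => by rw [← e, D.opp_opp], fun e => by rw [e, D.opp_opp]⟩
  simp only [Pi.sub_apply, Pi.single_apply, opp_eq_iff,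
    (Function.LeftInverse.injective D.opp_opp).eq_iff, neg_sub]

theorem single_two_sub_single_zero_mem (c : D.Crossing) :
    (Pi.single (c, 2) 1 - Pi.single (c, 0) 1 : D.HalfEdge → ℤ) ∈ overpassChains D := by
  intro c'
  simp [Pi.single_apply]

/-- The group of functions on the half-edges maps to the free abelian group on the arcs, and the
kernel is generated by the differences of half-edges that are joined by an edge or an overpass. -/
theorem mem_sup_of_linearCombination_eq_zero {w : D.Crossing → ℤ}
    (hw : ∑ c, w c • (Finsupp.single (D.b₁ c) (1 : ℤ) - Finsupp.single (D.b₂ c) 1) = 0) :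
    (∑ c, w c • (Pi.single (c, 3) 1 - Pi.single (c, 1) 1) : D.HalfEdge → ℤ) ∈
      antisymmetricChains D ⊔ overpassChains D := by
  let P : D.Arc → (D.HalfEdge → ℤ) ⧸ (antisymmetricChains D ⊔ overpassChains D) :=
    Sum.elim (Quot.lift (fun h => QuotientAddGroup.mk (Pi.single h 1)) (by
      rintro h _ (_ | c) <;> rw [QuotientAddGroup.eq, neg_add_eq_sub]
      · exact le_sup_left (a := antisymmetricChains D) (single_opp_sub_single_mem h)
      · exact le_sup_right (b := overpassChains D) (single_two_sub_single_zero_mem c))) 0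
  have hP (h : D.HalfEdge) : P (D.arcOf h) = QuotientAddGroup.mk (Pi.single h 1) := rfl
  have key := congrArg (Finsupp.linearCombination ℤ P) hw
  simp only [map_sum, map_smul, map_sub, Finsupp.linearCombination_single, one_smul, map_zero,
    b₁, b₂, hP] at key
  simp only [← QuotientAddGroup.mk_sub, ← QuotientAddGroup.mk_zsmul] at key
  rwa [← QuotientAddGroup.mk_sum, QuotientAddGroup.eq_zero_iff] at key

theorem exists_eq_underCycle {w : D.Crossing → ℤ}
    (hw : ∑ c, w c • (Finsupp.single (D.b₁ c) (1 : ℤ) - Finsupp.single (D.b₂ c) 1) = 0) :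
    ∃ g, w = underCycle g := by
  obtain ⟨f, hf, v, hv, hfv⟩ := AddSubgroup.mem_sup.1 (mem_sup_of_linearCombination_eq_zero hw)
  have hfv (h : D.HalfEdge) := congrFun hfv h
  have hf₁ (c : D.Crossing) : f (c, 1) = -w c := by
    simpa [(hv c).1, Finset.sum_apply, Pi.single_apply] using hfv (c, 1)
  have hf₃ (c : D.Crossing) : f (c, 3) = w c := by
    simpa [(hv c).2.1, Finset.sum_apply, Pi.single_apply] using hfv (c, 3)
  have hf₂ (c : D.Crossing) : f (c, 2) = -f (c, 0) := by
    have h₀ : f (c, 0) + v (c, 0) = 0 := by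
      simpa [Finset.sum_apply, Pi.single_apply] using hfv (c, 0)
    have h₂ : f (c, 2) + v (c, 2) = 0 := by
      simpa [Finset.sum_apply, Pi.single_apply] using hfv (c, 2)
    rw [(hv c).2.2] at h₂
    linarith
  let g : D.Component → ℤ := Sum.elim (Quot.lift (fun h => sgn h * f h) (by
    rintro h _ (_ | _)
    · rw [sgn_opp, hf, neg_mul_neg]
    · refine (apply_rot_rot (f := fun h => sgn h * f h) (fun c => ?_) (fun c => ?_) h).symm
      · rw [sgn_zero, sgn_two, hf₂, one_mul, neg_mul_neg, one_mul]
      · rw [sgn_three, hf₁, hf₃, mul_neg, neg_mul])) 0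
  refine ⟨-g, funext fun c => ?_⟩
  change w c = sgn (c, 1) * -(sgn (c, 3) * f (c, 3))
  rw [sgn_three, hf₃, neg_mul, neg_neg, ← mul_assoc, sgn_mul_self, one_mul]

/-- The longitudes of the components, with given multiplicities. -/
noncomputable def longitude : (D.Component → ℤ) →+ D.alexanderInvariantRed where
  toFun g := ∑ c, underCycle g c • arcDiff (D.a c) (D.b₁ c)
  map_zero' := by simp [underCycle]
  map_add' g g' := by
    simp only [underCycle, Pi.add_apply, mul_add, add_smul, Finset.sum_add_distrib]

theorem longitude_apply (g : D.Component → ℤ) :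
    longitude g = ∑ c, underCycle g c • arcDiff (D.a c) (D.b₁ c) := rfl

theorem rhoRed_apply (w : D.Crossing →₀ Lam) :
    D.rhoRed w = ∑ c, w c • ((1 - tt) • Finsupp.single (D.a c) (1 : Lam) +
      tt • Finsupp.single (D.b₁ c) 1 - Finsupp.single (D.b₂ c) 1) := by
  rw [rhoRed, Finsupp.linearCombination_apply, Finsupp.sum_fintype]
  simp

theorem exists_aug_eq_underCycle {v : D.Arc →₀ Lam} {w : D.Crossing →₀ Lam}
    (h : D.rhoRed w = (1 - tt) • v) : ∃ g, ∀ c, aug (w c) = underCycle g c := by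
  let A : (D.Arc →₀ Lam) →ₛₗ[aug] (D.Arc →₀ ℤ) := Finsupp.mapRange.linearMap aug.toSemilinearMap
  have hA (α : D.Arc) : A (Finsupp.single α 1) = Finsupp.single α 1 := by simp [A]
  have hAρ := congrArg A h
  simp only [rhoRed_apply, map_sum, map_smulₛₗ, map_sub, map_add, map_one, aug_T, hA, sub_self,
    zero_smul, zero_add, one_smul] at hAρ
  exact (exists_eq_underCycle hAρ).imp fun _ => congrFun

theorem rhoRed_underCycle (g : D.Component → ℤ) :
    D.rhoRed (Finsupp.equivFunOnFinite.symm fun c => (underCycle g c : Lam)) = (1 - tt) •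
      ∑ c, underCycle g c • (Finsupp.single (D.a c) (1 : Lam) - Finsupp.single (D.b₁ c) 1) := by
  rw [rhoRed_apply, Finset.smul_sum, ← sub_eq_zero, ← Finset.sum_sub_distrib, ← neg_eq_zero,
    ← Finset.sum_neg_distrib,
    ← sum_underCycle_smul g fun α => (Finsupp.single α 1 : D.Arc →₀ Lam)]
  refine Finset.sum_congr rfl fun c _ => ?_
  rw [Finsupp.equivFunOnFinite_symm_apply_apply]
  module

theorem mkQ_eq_longitude {v : D.Arc →₀ Lam} {w : D.Crossing →₀ Lam} {g : D.Component → ℤ}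
    (h : D.rhoRed w = (1 - tt) • v) (hg : ∀ c, aug (w c) = underCycle g c) :
    (LinearMap.range D.rhoRed).mkQ v = longitude g := by
  have hdvd (c : D.Crossing) : (1 - tt) ∣ w c - underCycle g c := by
    rw [← aug_eq_zero_iff, map_sub, hg, map_intCast, Int.cast_id, sub_self]
  choose w' hw' using hdvd
  have hw : w = (Finsupp.equivFunOnFinite.symm fun c => (underCycle g c : Lam)) +
      (1 - tt) • Finsupp.equivFunOnFinite.symm w' := by
    ext1 c
    simp [← hw' c]
  rw [hw, map_add, map_smul, rhoRed_underCycle, ← smul_add] at h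
  have hρ : (LinearMap.range D.rhoRed).mkQ (D.rhoRed (Finsupp.equivFunOnFinite.symm w')) = 0 :=
    (Submodule.Quotient.mk_eq_zero _).2 ⟨_, rfl⟩
  rw [← smul_right_injective _ one_sub_tt_ne_zero h, map_add, hρ, add_zero, longitude_apply]
  simp only [map_sum, map_zsmul, map_sub, AddSubmonoidClass.coe_finsetSum,
    AddSubgroupClass.coe_zsmul, coe_arcDiff, arcClass]

theorem exists_eq_longitude {x : D.alexanderInvariantRed} (hx : (1 - tt) • x = 0) :
    ∃ g, x = longitude g := by
  obtain ⟨v, hv⟩ := (LinearMap.range D.rhoRed).mkQ_surjective x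
  obtain ⟨w, hw⟩ : (1 - tt) • v ∈ LinearMap.range D.rhoRed := by
    rw [← Submodule.Quotient.mk_eq_zero, ← Submodule.mkQ_apply, map_smul, hv]
    exact congrArg Subtype.val hx
  obtain ⟨g, hg⟩ := exists_aug_eq_underCycle hw
  exact ⟨g, Subtype.ext (hv.symm.trans (mkQ_eq_longitude hw hg))⟩

/-- A longitude runs along its own component from `α` back to `α`, and each underpass acts as the
displacement by `arcDiff (a c) (b₁ c)`. -/
theorem longitude_single_vadd [DecidableEq D.Component] (α : D.Arc) :
    longitude (Pi.single (componentOf α) 1) +ᵥ arcElement α = arcElement α := by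
  have exists_path (β : D.Arc) : ∃ m : D.alexanderInvariantRed,
      componentOf β = componentOf α → m +ᵥ arcElement α = arcElement β := by
    by_cases h : componentOf β = componentOf α
    · exact (AddAction.orbit_eq_iff.1 (orbit_arcElement_eq h)).imp fun _ hm _ => hm
    · exact ⟨0, fun h' => absurd h' h⟩
  choose p hp using exists_path
  let S := AddAction.stabilizer D.alexanderInvariantRed (arcElement α)
  change _ ∈ S
  rw [← QuotientAddGroup.eq_zero_iff, longitude_apply, QuotientAddGroup.mk_sum,
    ← sum_underCycle_smul (Pi.single (componentOf α) 1)
      fun β => (p β : D.alexanderInvariantRed ⧸ S)]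
  refine Finset.sum_congr rfl fun c _ => ?_
  rw [QuotientAddGroup.mk_zsmul]
  by_cases hc : componentOf (D.b₁ c) = componentOf α
  · have hb₂ : (arcDiff (D.a c) (D.b₁ c) + p (D.b₁ c)) +ᵥ arcElement α =
        p (D.b₂ c) +ᵥ arcElement α := by
      rw [add_vadd, hp _ hc, hp _ ((componentOf_b₂ c).trans hc), ← moduleDiff_arcElement,
        moduleDiff_vadd_self, arcElement, arcElement, PresentedMedialQuandle.act_of]
    congr 1
    rw [eq_sub_iff_add_eq, ← QuotientAddGroup.mk_add, QuotientAddGroup.eq,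
      AddAction.mem_stabilizer_iff, add_vadd, ← hb₂, neg_vadd_vadd]
  · rw [underCycle, Pi.single_eq_of_ne hc, mul_zero, zero_smul, zero_smul]

theorem longitude_eq_zsmul (hμ : D.numComponents = 2) (h₁ : longitude (1 : D.Component → ℤ) = 0)
    [DecidableEq D.Component] (g : D.Component → ℤ) (i : D.Component) :
    ∃ k : ℤ, longitude g = k • longitude (Pi.single i 1) := by
  obtain ⟨j, hji, -⟩ := (Nat.card_eq_two_iff' i).1 hμ
  have hg : g = (g i - g j) • Pi.single i 1 + g j • (1 : D.Component → ℤ) := by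
    ext k
    obtain rfl | rfl := eq_or_eq_of_ne hμ hji k <;> simp [hji]
  refine ⟨g i - g j, ?_⟩
  conv_lhs => rw [hg, map_add, map_zsmul, map_zsmul, h₁, smul_zero, add_zero]

theorem toModule_injective (hμ : D.numComponents = 2)
    (h₁ : longitude (1 : D.Component → ℤ) = 0) : Function.Injective (toModule (D := D)) := by
  classical
  refine toModule_injective_of_vadd_eq fun m α hm => ?_
  obtain ⟨g, rfl⟩ := exists_eq_longitude hm
  obtain ⟨k, hk⟩ := longitude_eq_zsmul hμ h₁ g (componentOf α)
  rw [hk, ← AddAction.mem_stabilizer_iff]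
  exact zsmul_mem (longitude_single_vadd α) k

end LinkDiagram

/-! ### Alexander numberings -/

/-- The functions that are constant along a relation. -/
def constantAlong {H : Type*} (r : H → H → Prop) : Submodule ℝ (EuclideanSpace ℝ H) where
  carrier := {f | ∀ h h', r h h' → f h = f h'}
  add_mem' hf hg h h' hr := by simp [hf h h' hr, hg h h' hr]
  zero_mem' _ _ _ := rfl
  smul_mem' a f hf h h' hr := by simp [hf h h' hr]

theorem finrank_constantAlong {H : Type*} [Finite H] (r : H → H → Prop) :
    Module.finrank ℝ (constantAlong r) = Nat.card (Quot r) := by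
  have := Fintype.ofFinite (Quot r)
  let e : (Quot r → ℝ) ≃ₗ[ℝ] constantAlong r :=
    { toFun f := ⟨WithLp.toLp 2 fun h => f (Quot.mk r h), fun h h' hr => by simp [Quot.sound hr]⟩
      map_add' _ _ := rfl
      map_smul' _ _ := rfl
      invFun f := Quot.lift f.1 f.2
      left_inv f := funext (Quot.ind fun _ => rfl)
      right_inv _ := rfl }
  rw [← e.finrank_eq, Module.finrank_fintype_fun_eq_card, Nat.card_eq_fintype_card]

theorem constantAlong_inf {H : Type*} (r r' : H → H → Prop) :
    constantAlong r ⊓ constantAlong r' = constantAlong fun h h' => r h h' ∨ r' h h' := by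
  ext f
  exact ⟨fun hf h h' => Or.rec (hf.1 h h') (hf.2 h h'),
    fun hf => ⟨fun h h' hr => hf h h' (.inl hr), fun h h' hr => hf h h' (.inr hr)⟩⟩

section Coboundary

variable {H : Type*} {σ τ : Equiv.Perm H}

/-- The function that takes a function on `H` to its differences along a permutation. -/
noncomputable def coboundary (σ : Equiv.Perm H) :
    EuclideanSpace ℝ H →ₗ[ℝ] EuclideanSpace ℝ H where
  toFun f := WithLp.toLp 2 fun h => f h - f (σ h)
  map_add' f g := by
    ext h
    simp only [PiLp.add_apply]
    ring
  map_smul' a f := by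
    ext h
    simp [mul_sub]

@[simp] theorem coboundary_apply (f : EuclideanSpace ℝ H) (h : H) :
    coboundary σ f h = f h - f (σ h) := rfl

theorem apply_eq_of_mem_constantAlong {f : EuclideanSpace ℝ H}
    (hf : f ∈ constantAlong fun h h' => h' = τ (σ⁻¹ h)) (h : H) : f (σ h) = f (τ h) := by
  simpa using hf (σ h) _ rfl

theorem finrank_ker_coboundary_le [Finite H] : Module.finrank ℝ (LinearMap.ker
    ((coboundary σ).domRestrict (constantAlong fun h h' => h' = τ (σ⁻¹ h)))) ≤
      Nat.card (Quot fun h h' => h' = σ h ∨ h' = τ h) := by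
  rw [← finrank_constantAlong, ← Submodule.finrank_map_subtype_eq]
  apply Submodule.finrank_mono
  rintro _ ⟨⟨f, hf⟩, hf', rfl⟩
  have apply_σ (h : H) : f h = f (σ h) :=
    sub_eq_zero.1 (congrArg (fun g : EuclideanSpace ℝ H => g h) hf')
  rintro h _ (rfl | rfl)
  exacts [apply_σ h, (apply_σ h).trans (apply_eq_of_mem_constantAlong hf h)]

variable [Fintype H]

theorem mem_orthogonal_constantAlong_iff {φ : H → H} {s : EuclideanSpace ℝ H} :
    s ∈ (constantAlong fun h h' => h' = φ h)ᗮ ↔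
      ∀ g : H → ℝ, (∀ h, g (φ h) = g h) → ∑ h, g h * s h = 0 := by
  rw [Submodule.mem_orthogonal']
  constructor
  · intro hs g hg
    simpa [PiLp.inner_apply] using hs (WithLp.toLp 2 g) fun h h' e => by simp [e, hg]
  · intro hs g hg
    simpa [PiLp.inner_apply] using hs g fun h => (hg h _ rfl).symm

theorem map_coboundary_le : (constantAlong fun h h' => h' = τ (σ⁻¹ h)).map (coboundary σ) ≤
    (constantAlong (fun h h' => h' = σ h) ⊔ constantAlong fun h h' => h' = τ h)ᗮ := by
  rintro _ ⟨f, hf, rfl⟩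
  rw [← Submodule.inf_orthogonal, Submodule.mem_inf, mem_orthogonal_constantAlong_iff,
    mem_orthogonal_constantAlong_iff]
  have sum_eq_zero (ρ : Equiv.Perm H) (hρ : ∀ h, f (σ h) = f (ρ h)) (g : H → ℝ)
      (hg : ∀ h, g (ρ h) = g h) : ∑ h, g h * coboundary σ f h = 0 := by
    simp only [coboundary_apply, hρ, mul_sub, Finset.sum_sub_distrib]
    rw [sub_eq_zero, ← Equiv.sum_comp ρ fun h => g h * f h]
    simp only [hg]
  exact ⟨sum_eq_zero σ fun _ => rfl, sum_eq_zero τ (apply_eq_of_mem_constantAlong hf)⟩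

/-- The hypothesis says that the surface formed by the cycles of `σ`, `τ` and `τ σ⁻¹` has genus
zero, so that its first cohomology vanishes. -/
theorem map_coboundary_eq
    (hgenus : Nat.card H + 2 * Nat.card (Quot fun h h' => h' = σ h ∨ h' = τ h) ≤
      Nat.card (Quot fun h h' => h' = σ h) + Nat.card (Quot fun h h' => h' = τ h) +
        Nat.card (Quot fun h h' => h' = τ (σ⁻¹ h))) :
    (constantAlong fun h h' => h' = τ (σ⁻¹ h)).map (coboundary σ) =
      (constantAlong (fun h h' => h' = σ h) ⊔ constantAlong fun h h' => h' = τ h)ᗮ := by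
  refine Submodule.eq_of_le_of_finrank_le map_coboundary_le ?_
  have finrank_orthogonal := Submodule.finrank_add_finrank_orthogonal
    (constantAlong (fun h h' => h' = σ h) ⊔ constantAlong fun h h' => h' = τ h)
  have finrank_sup := Submodule.finrank_sup_add_finrank_inf_eq
    (constantAlong fun h h' => h' = σ h) (constantAlong fun h h' => h' = τ h)
  have finrank_map := LinearMap.finrank_range_add_finrank_ker
    ((coboundary σ).domRestrict (constantAlong fun h h' => h' = τ (σ⁻¹ h)))
  have finrank_ker := finrank_ker_coboundary_le (σ := σ) (τ := τ)
  rw [LinearMap.range_domRestrict] at finrank_map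
  rw [constantAlong_inf] at finrank_sup
  simp only [finrank_constantAlong, finrank_euclideanSpace, Nat.card_eq_fintype_card (α := H)]
    at finrank_orthogonal finrank_sup finrank_map finrank_ker hgenus ⊢
  omega

theorem exists_potential
    (hgenus : Nat.card H + 2 * Nat.card (Quot fun h h' => h' = σ h ∨ h' = τ h) ≤
      Nat.card (Quot fun h h' => h' = σ h) + Nat.card (Quot fun h h' => h' = τ h) +
        Nat.card (Quot fun h h' => h' = τ (σ⁻¹ h))) {s : H → ℤ}
    (hσ : ∀ g : H → ℝ, (∀ h, g (σ h) = g h) → ∑ h, g h * s h = 0)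
    (hτ : ∀ g : H → ℝ, (∀ h, g (τ h) = g h) → ∑ h, g h * s h = 0) :
    ∃ U : H → ℤ, (∀ h, U (σ h) = U (τ h)) ∧ ∀ h, U h - U (σ h) = s h := by
  have hs : WithLp.toLp 2 (fun h => (s h : ℝ)) ∈
      (constantAlong fun h h' => h' = τ (σ⁻¹ h)).map (coboundary σ) := by
    rw [map_coboundary_eq hgenus, ← Submodule.inf_orthogonal]
    exact ⟨mem_orthogonal_constantAlong_iff.2 hσ, mem_orthogonal_constantAlong_iff.2 hτ⟩
  obtain ⟨f, hf, hfs⟩ := hs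
  refine ⟨fun h => ⌊f h⌋, fun h => congrArg Int.floor (apply_eq_of_mem_constantAlong hf h),
    fun h => ?_⟩
  have hfh : f h - f (σ h) = s h := congrArg (fun g : EuclideanSpace ℝ H => g h) hfs
  change ⌊f h⌋ - ⌊f (σ h)⌋ = s h
  rw [sub_eq_iff_eq_add'.1 hfh, Int.floor_add_intCast, add_sub_cancel_left]

end Coboundary

namespace LinkDiagram

variable {D : LinkDiagram}

/-- An Alexander numbering of the faces: the number to the right of an edge exceeds by one the
number to the left of it. Here `Quot.mk _ h` and `Quot.mk _ (rot h)` are the two faces along the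
edge of `h`, the former being on the right of an observer who walks away from the crossing along
`h`. -/
def IsAlexanderNumbering (U : D.Face → ℤ) : Prop :=
  ∀ h, U (Quot.mk _ h) - U (Quot.mk _ (D.rot h)) = sgn h

/-- A diagram is almost classical if its faces have an Alexander numbering. -/
def IsAlmostClassical (D : LinkDiagram) : Prop := ∃ U : D.Face → ℤ, IsAlexanderNumbering U

theorem card_le_two_mul_card_quot_opp (D : LinkDiagram) :
    Nat.card D.HalfEdge ≤ 2 * Nat.card (Quot fun h h' : D.HalfEdge => h' = D.opp h) := by
  let outgoingEnd : (Quot fun h h' : D.HalfEdge => h' = D.opp h) → D.HalfEdge :=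
    Quot.lift (fun h => if halfEdgeOut D.positive h then h else D.opp h) (by
      rintro h _ rfl
      rw [D.out_opp, D.opp_opp]
      cases halfEdgeOut D.positive h <;> rfl)
  let φ (h : D.HalfEdge) : (Quot fun h h' : D.HalfEdge => h' = D.opp h) × Bool :=
    (Quot.mk _ h, halfEdgeOut D.positive h)
  have hφ : Function.Injective φ := by
    intro h h' e
    have hout : halfEdgeOut D.positive h = halfEdgeOut D.positive h' := congrArg Prod.snd e
    have hend : outgoingEnd (Quot.mk _ h) = outgoingEnd (Quot.mk _ h') :=
      congrArg (outgoingEnd ∘ Prod.fst) e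
    simp only [outgoingEnd, hout] at hend
    split_ifs at hend
    exacts [hend, (Function.LeftInverse.injective D.opp_opp) hend]
  simpa [mul_comm] using Nat.card_le_card_of_injective φ hφ

theorem n_le_card_quot_rot (D : LinkDiagram) :
    D.n ≤ Nat.card (Quot fun h h' : D.HalfEdge => h' = D.rot h) := by
  let crossing : (Quot fun h h' : D.HalfEdge => h' = D.rot h) → D.Crossing :=
    Quot.lift Prod.fst (by rintro h _ rfl; rfl)
  simpa using Nat.card_le_card_of_surjective crossing fun c => ⟨Quot.mk _ (c, 0), rfl⟩

theorem sum_mul_sgn_eq_zero_of_opp {R : Type*} [Ring R] (g : D.HalfEdge → R)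
    (hg : ∀ h, g (D.opp h) = g h) : ∑ h, g h * sgn h = 0 :=
  sum_eq_zero_of_opp fun h => by rw [hg, sgn_opp, Int.cast_neg, mul_neg]

theorem sum_mul_sgn_eq_zero_of_rot {R : Type*} [Ring R] (g : D.HalfEdge → R)
    (hg : ∀ h, g (D.rot h) = g h) : ∑ h, g h * sgn h = 0 := by
  rw [sum_halfEdge]
  refine Finset.sum_eq_zero fun c _ => ?_
  have h₁ : g (c, 1) = g (c, 0) := hg (c, 0)
  have h₂ : g (c, 2) = g (c, 1) := hg (c, 1)
  have h₃ : g (c, 3) = g (c, 2) := hg (c, 2)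
  simp [h₁, h₂, h₃]

theorem IsClassical.isAlmostClassical (hD : D.IsClassical) : D.IsAlmostClassical := by
  let σ : Equiv.Perm D.HalfEdge := Function.Involutive.toPerm D.opp D.opp_opp
  let τ : Equiv.Perm D.HalfEdge := (Equiv.refl _).prodCongr (Equiv.addRight 1)
  have hpiece : D.PieceStep = fun h h' => h' = σ h ∨ h' = τ h := by
    ext h h'
    constructor
    · rintro (_ | _)
      exacts [.inl rfl, .inr rfl]
    · rintro (rfl | rfl)
      exacts [.edge h, .turn h]
  have hgenus : Nat.card D.HalfEdge + 2 * Nat.card (Quot fun h h' => h' = σ h ∨ h' = τ h) ≤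
      Nat.card (Quot fun h h' => h' = σ h) + Nat.card (Quot fun h h' => h' = τ h) +
        Nat.card (Quot fun h h' => h' = τ (σ⁻¹ h)) := by
    have hH : Nat.card D.HalfEdge = 4 * D.n := by simp [mul_comm]
    have hopp := D.card_le_two_mul_card_quot_opp
    have hrot := D.n_le_card_quot_rot
    rw [IsClassical, Piece, hpiece] at hD
    change _ ≤ Nat.card (Quot fun h h' : D.HalfEdge => h' = D.opp h) +
      Nat.card (Quot fun h h' : D.HalfEdge => h' = D.rot h) + Nat.card D.Face
    omega
  obtain ⟨U, hU, hUs⟩ :=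
    exists_potential hgenus sum_mul_sgn_eq_zero_of_opp sum_mul_sgn_eq_zero_of_rot
  have hface (h : D.HalfEdge) : U h = U (D.rot (D.opp h)) :=
    (congrArg U (D.opp_opp h)).symm.trans (hU (D.opp h))
  refine ⟨Quot.lift U (by rintro h _ rfl; exact hface h), fun h => ?_⟩
  change U h - U (τ h) = _
  rw [← hU, hUs]

/-- The larger one of the numbers of the two faces along the edge of a half-edge. -/
def edgeNumber (U : D.Face → ℤ) (h : D.HalfEdge) : ℤ :=
  max (U (Quot.mk _ h)) (U (Quot.mk _ (D.rot h)))

theorem edgeNumber_opp (U : D.Face → ℤ) (h : D.HalfEdge) :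
    edgeNumber U (D.opp h) = edgeNumber U h := by
  have face_opp (h : D.HalfEdge) :
      (Quot.mk _ (D.rot (D.opp h)) : D.Face) = Quot.mk _ h :=
    (Quot.sound (r := fun h h' => h' = D.rot (D.opp h)) rfl).symm
  have face_rot : (Quot.mk _ (D.rot h) : D.Face) = Quot.mk _ (D.opp h) := by
    rw [← face_opp (D.opp h), D.opp_opp]
  rw [edgeNumber, edgeNumber, face_opp, face_rot, max_comm]

theorem IsAlexanderNumbering.edgeNumber_three {U : D.Face → ℤ} (hU : IsAlexanderNumbering U)
    (c : D.Crossing) :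
    edgeNumber U (c, 3) = edgeNumber U (c, 1) + 1 := by
  have h₀ : U (Quot.mk _ (c, 0)) - U (Quot.mk _ (c, 1)) = 1 := hU (c, 0)
  have h₂ : U (Quot.mk _ (c, 2)) - U (Quot.mk _ (c, 3)) = -1 := hU (c, 2)
  change max (U (Quot.mk _ (c, 3))) (U (Quot.mk _ (c, 0))) =
    max (U (Quot.mk _ (c, 1))) (U (Quot.mk _ (c, 2))) + 1
  lia

theorem IsAlexanderNumbering.T_edgeNumber_two_sub {U : D.Face → ℤ} (hU : IsAlexanderNumbering U)
    (c : D.Crossing) :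
    (T (edgeNumber U (c, 2)) - T (edgeNumber U (c, 0)) : Lam) =
      sgn (D := D) (c, 1) • ((1 - tt) * T (edgeNumber U (c, 1))) := by
  have h₀ : U (Quot.mk _ (c, 0)) - U (Quot.mk _ (c, 1)) = 1 := hU (c, 0)
  have h₁ : U (Quot.mk _ (c, 1)) - U (Quot.mk _ (c, 2)) = sgn (c, 1) := hU (c, 1)
  have h₂ : U (Quot.mk _ (c, 2)) - U (Quot.mk _ (c, 3)) = -1 := hU (c, 2)
  have e₀ : edgeNumber U (c, 0) = max (U (Quot.mk _ (c, 0))) (U (Quot.mk _ (c, 1))) := rfl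
  have e₁ : edgeNumber U (c, 1) = max (U (Quot.mk _ (c, 1))) (U (Quot.mk _ (c, 2))) := rfl
  have e₂ : edgeNumber U (c, 2) = max (U (Quot.mk _ (c, 2))) (U (Quot.mk _ (c, 3))) := rfl
  rw [sub_mul, one_mul, ← T_add]
  rw [sgn_one] at h₁ ⊢
  split_ifs at h₁ ⊢
  · rw [one_smul, show edgeNumber U (c, 2) = edgeNumber U (c, 1) by lia,
      show edgeNumber U (c, 0) = 1 + edgeNumber U (c, 1) by lia]
  · rw [neg_smul, one_smul, neg_sub, show edgeNumber U (c, 2) = 1 + edgeNumber U (c, 1) by lia,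
      show edgeNumber U (c, 0) = edgeNumber U (c, 1) by lia]

/-- The half-edges, weighted by `± t ^ edgeNumber`, cancel in pairs along the edges, while their sum
at each crossing is a multiple of the relation at that crossing. -/
theorem IsAlmostClassical.exists_rhoRed_eq_zero (hD : D.IsAlmostClassical) :
    ∃ r : D.Crossing →₀ Lam, D.rhoRed r = 0 ∧ ∀ c, aug (r c) = sgn (D := D) (c, 1) := by
  obtain ⟨U, hU⟩ := hD
  let x (h : D.HalfEdge) : D.Arc →₀ Lam :=
    (T (edgeNumber U h) : Lam) • Finsupp.single (D.arcOf h) 1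
  have key : ∑ h, sgn h • x h = 0 := sum_eq_zero_of_opp fun h => by
    simp only [x, sgn_opp, edgeNumber_opp, arcOf_opp, neg_smul]
  refine ⟨Finsupp.equivFunOnFinite.symm fun c => sgn (D := D) (c, 1) • T (edgeNumber U (c, 1)), ?_,
    fun c => by simp⟩
  rw [rhoRed_apply, ← neg_eq_zero, ← key, sum_halfEdge, ← Finset.sum_neg_distrib]
  refine Finset.sum_congr rfl fun c _ => ?_
  have hx₀ : x (c, 0) = (T (edgeNumber U (c, 0)) : Lam) • Finsupp.single (D.a c) 1 := rfl
  have hx₁ : x (c, 1) = (T (edgeNumber U (c, 1)) : Lam) • Finsupp.single (D.b₂ c) 1 := rfl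
  have hx₂ : x (c, 2) = (T (edgeNumber U (c, 0)) +
      sgn (D := D) (c, 1) • ((1 - tt) * T (edgeNumber U (c, 1))) : Lam) •
        Finsupp.single (D.a c) 1 := by
    rw [← hU.T_edgeNumber_two_sub, add_sub_cancel, ← arcOf_two]
  have hx₃ : x (c, 3) = (tt * T (edgeNumber U (c, 1)) : Lam) • Finsupp.single (D.b₁ c) 1 := by
    rw [← T_add, add_comm, ← hU.edgeNumber_three]
    rfl
  rw [hx₀, hx₁, hx₂, hx₃, sgn_zero, sgn_two, sgn_three, Finsupp.equivFunOnFinite_symm_apply_apply]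
  module

theorem IsAlmostClassical.longitude_one (hD : D.IsAlmostClassical) :
    longitude (1 : D.Component → ℤ) = 0 := by
  obtain ⟨r, hr, haug⟩ := hD.exists_rhoRed_eq_zero
  have h := mkQ_eq_longitude (v := 0) (w := r) (g := 1) (by rw [hr, smul_zero])
    fun c => by rw [haug, underCycle, Pi.one_apply, mul_one]
  rw [map_zero] at h
  exact Subtype.ext h.symm

end LinkDiagram

/-! ### The medial quandles `Q(N, (mᵢ), (Xᵢ))` as Alexander quandles -/

namespace MedialData

variable {M : Type*} [AddCommGroup M] [Module Lam M] {N : Submodule Lam M} {I : Type*}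

/-- The homomorphism from `Q(N, (mᵢ), (Xᵢ))` to the Alexander quandle of `M` that takes `x + Xᵢ` to
`e + mᵢ + (1 - t) x`. -/
noncomputable def toModule (S : MedialData N I) (e : M) : S.Q →◃ M where
  toFun q := e + S.m q.1 +
    ((S.X q.1).liftQ (N.subtype ∘ₗ LinearMap.lsmul Lam N (1 - tt)) fun x hx => by
      simp only [LinearMap.mem_ker, LinearMap.comp_apply, LinearMap.lsmul_apply, S.ann _ x hx,
        map_zero]) q.2
  map_act' {y x} := by
    obtain ⟨j, y, rfl⟩ := S.exists_coset y
    obtain ⟨i, x, rfl⟩ := S.exists_coset x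
    change e + S.m i + (((1 - tt) • (S.diff j i + tt • x + (1 - tt) • y) : N) : M) =
      (e + S.m j + (((1 - tt) • y : N) : M)) ◃ (e + S.m i + (((1 - tt) • x : N) : M))
    rw [alexanderQuandle_act]
    simp only [diff, Submodule.coe_add, Submodule.coe_smul]
    module

variable {S : MedialData N I} {e : M}

theorem toModule_coset (i : I) (x : N) :
    S.toModule e (S.coset i x) = e + S.m i + (1 - tt) • (x : M) := rfl

theorem range_toModule :
    Set.range (S.toModule e) = {u | ∃ i, ∃ x : N, u = e + S.m i + (1 - tt) • (x : M)} := by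
  ext u
  constructor
  · rintro ⟨q, rfl⟩
    obtain ⟨i, x, rfl⟩ := S.exists_coset q
    exact ⟨i, x, rfl⟩
  · rintro ⟨i, x, rfl⟩
    exact ⟨S.coset i x, rfl⟩

theorem toModule_injective (hX : ∀ i, Submodule.torsionBy Lam N (1 - tt) ≤ S.X i)
    (hm : ∀ i j, S.diff i j ∈ oneSubTMul N → i = j) : Function.Injective (S.toModule e) := by
  intro p q h
  obtain ⟨i, x, rfl⟩ := S.exists_coset p
  obtain ⟨j, y, rfl⟩ := S.exists_coset q
  have hdiff : S.diff i j = (1 - tt) • (y - x) := Subtype.ext (by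
    rw [toModule_coset, toModule_coset, add_assoc, add_assoc, add_right_inj] at h
    rw [diff, Submodule.coe_smul, Submodule.coe_sub, smul_sub, sub_eq_sub_iff_add_eq_add, h,
      add_comm])
  obtain rfl := hm i j ⟨y - x, hdiff.symm⟩
  refine congrArg (Sigma.mk i) ((Submodule.Quotient.eq _).2 (hX i ?_))
  rw [Submodule.mem_torsionBy_iff, ← neg_sub y x, smul_neg, ← hdiff, neg_eq_zero]
  exact Subtype.ext (sub_self _)

theorem pair_diff_zero_one (d : N) : (pair N d).diff 0 1 = d := Subtype.ext (sub_zero _)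

theorem pair_diff_one_zero (d : N) : (pair N d).diff 1 0 = -d := Subtype.ext (zero_sub _)

theorem pair_toModule_injective {d : N} (hd : d ∉ oneSubTMul N) :
    Function.Injective ((pair N d).toModule e) := by
  refine toModule_injective (fun _ => le_rfl) fun i j h => ?_
  fin_cases i <;> fin_cases j
  · rfl
  · exact absurd (by rwa [← pair_diff_zero_one d]) hd
  · exact absurd (by rwa [← neg_mem_iff, ← pair_diff_one_zero d]) hd
  · rfl

end MedialData

namespace LinkDiagram

variable {D : LinkDiagram}

theorem range_pair_toModule (hμ : D.numComponents = 2) {α₁ α₂ : D.Arc}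
    (hne : componentOf α₁ ≠ componentOf α₂) {d : D.alexanderInvariantRed}
    (hd : d - arcDiff α₁ α₂ ∈ oneSubTMul D.alexanderInvariantRed) :
    Set.range ((MedialData.pair _ d).toModule (arcClass α₂)) = Set.range (toModule (D := D)) := by
  have arcClass_eq {α β : D.Arc} (h : componentOf α = componentOf β) :
      ∃ n : D.alexanderInvariantRed,
        arcClass α = arcClass β + (1 - tt) • (n : D.AlexanderModuleRed) := by
    obtain ⟨n, hn⟩ := arcDiff_mem_oneSubTMul_iff.2 h
    exact ⟨n, sub_eq_iff_eq_add'.1 (congrArg Subtype.val hn).symm⟩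
  obtain ⟨n, hn⟩ := hd
  have add_d : arcClass α₂ + (d : D.AlexanderModuleRed) =
      arcClass α₁ + (1 - tt) • (n : D.AlexanderModuleRed) := by
    have h : (1 - tt) • (n : D.AlexanderModuleRed) = d - (arcClass α₁ - arcClass α₂) :=
      congrArg Subtype.val hn
    rw [h]
    abel
  rw [MedialData.range_toModule, range_toModule]
  refine Set.Subset.antisymm ?_ ?_
  · rintro _ ⟨i, x, rfl⟩
    fin_cases i
    · refine ⟨α₁, n + x, ?_⟩
      change arcClass α₂ + (d : D.AlexanderModuleRed) + _ = _
      rw [add_d, add_assoc, ← smul_add, Submodule.coe_add]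
    · exact ⟨α₂, x, congrArg (· + _) (add_zero _)⟩
  · rintro _ ⟨α, x, rfl⟩
    obtain h | h := eq_or_eq_of_ne hμ hne (componentOf α) <;> obtain ⟨m, hm⟩ := arcClass_eq h
    · refine ⟨0, m + x - n, ?_⟩
      change _ = arcClass α₂ + (d : D.AlexanderModuleRed) + _
      rw [hm, add_d, Submodule.coe_sub, Submodule.coe_add]
      module
    · refine ⟨1, m + x, ?_⟩
      change _ = arcClass α₂ + (0 : D.AlexanderModuleRed) + _
      rw [hm, add_zero, add_assoc, ← smul_add, Submodule.coe_add]

theorem notMem_oneSubTMul_of_sub_arcDiff_mem {α₁ α₂ : D.Arc}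
    (hne : componentOf α₁ ≠ componentOf α₂) {d : D.alexanderInvariantRed}
    (hd : d - arcDiff α₁ α₂ ∈ oneSubTMul D.alexanderInvariantRed) :
    d ∉ oneSubTMul D.alexanderInvariantRed := fun h =>
  hne (arcDiff_mem_oneSubTMul_iff.1 ((Submodule.sub_mem_iff_right _ h).1 hd))

end LinkDiagram

theorem mainTheorem4_general (D : LinkDiagram) (hD : D.IsAlmostClassical)
    (hμ : D.numComponents = 2) :
    Nonempty ((D.alexanderInvariantRed ⧸ oneSubTMul D.alexanderInvariantRed) ≃+ ℤ) ∧
      ∀ d : D.alexanderInvariantRed,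
        Submodule.span Lam {(oneSubTMul D.alexanderInvariantRed).mkQ d} = ⊤ →
          ∃ f : D.MQ →◃ (MedialData.pair D.alexanderInvariantRed d).Q,
            Function.Bijective f := by
  constructor
  · obtain ⟨i, -⟩ := Nat.card_eq_two_iff.1 hμ
    exact ⟨.ofBijective _ (D.invariantDegree_bijective hμ i)⟩
  · intro d hd
    obtain ⟨α₁, α₂, hne, hmem⟩ := D.exists_sub_arcDiff_mem hμ hd
    exact exists_bijective_shelfHom
      (LinkDiagram.toModule_injective hμ hD.longitude_one)
      (MedialData.pair_toModule_injective
        (LinkDiagram.notMem_oneSubTMul_of_sub_arcDiff_mem hne hmem))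
      (LinkDiagram.range_pair_toModule hμ hne hmem).symm

theorem mainTheorem4 (D : LinkDiagram) (hD : D.IsClassical) (hμ : D.numComponents = 2) :
    Nonempty ((D.alexanderInvariantRed ⧸ oneSubTMul D.alexanderInvariantRed) ≃+ ℤ) ∧
      ∀ d : D.alexanderInvariantRed,
        Submodule.span Lam {(oneSubTMul D.alexanderInvariantRed).mkQ d} = ⊤ →
          ∃ f : D.MQ →◃ (MedialData.pair D.alexanderInvariantRed d).Q,
            Function.Bijective f :=
  mainTheorem4_general D hD.isAlmostClassical hμ
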